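/- Let $M$ be an inverse monoid given by an inverse monoid presentation $\mathcal P=[X:\mathcal R]$: here $A=X\sqcup X^{-1}$, $\mathcal R\subseteq A^*\times A^*$, $\rho:A^*\to \mathrm{FIM}(X)$ is the canonical map to the free inverse monoid, and $\theta:\mathrm{FIM}(X)\to M$ is a surjective homomorphism whose induced congruence is generated by the pairs $(l\rho,r\rho)$ with $(l,r)\in\mathcal R$. *Lausch modules.* For an inverse monoid $S$ with idempotents $E(S)$ (ordered by $f\le e\iff f=ef$), an $S$-module is a presheaf of abelian groups $A_e$ $(e\in E(S))$ over the semilattice $E(S)$ with a map $(a,s)\mapsto a\lhd s$ from $A\times S$ to $A$, where $A=\bigsqcup_e A_e$ carries the operation $a\oplus b=a|_{ef}+b|_{ef}$ for $a\in A_e$, $b\in A_f$, such that $(a\oplus b)\lhd s=(a\lhd s)\oplus(b\lhd s)$, $a\lhd st=(a\lhd s)\lhd t$, $a\lhd e=a\oplus 0_e$ and $0_e\lhd s=0_{s^{-1}es}$ for all $a,b\in A$, $s,t\in S$, $e\in E(S)$. The free $S$-module on a family of sets $(B_f)_{f\in E(S)}$ has as $F_e$ the free abelian group on $\{(b,s):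 b\in B_f,\ s\in S,\ f\ge ss^{-1},\ s^{-1}s=e\}$, with $(b,s)\lhd t=(b,st)$ and $(b,s)|_{e'}=(b,se')$; a module is free if it is isomorphic to one of these. Exactness of a sequence of $S$-modules means exactness at every $e\in E(S)$. *The relation module.* For $a,b\in\mathrm{FIM}(X)$ let $a\,\theta_{\min}\,b$ if there is an idempotent $e$ with $ae=be$ and $(a^{-1}a)\theta=e\theta=(b^{-1}b)\theta$. This is a congruence. Put $\mathcal T=\mathrm{FIM}(X)/\theta_{\min}$, and factor $\theta$ as $\mathrm{FIM}(X)\xrightarrow{\tau}\mathcal T\xrightarrow{\psi}M$. Then $\psi$ restricts to a bijection $E(\mathcal T)\to E(M)$, by which these sets are identified. For each idempotent $e$, $K_e=\{k\in\mathcal T:k\psi=e\psi\}$ is a group with identity $e$, and the relation module is the $M$-module $\mathcal K=\bigsqcup_e K_e^{ab}$ with $\overline{k}\lhd m=\overline{t^{-1}kt}$ for any $t\in\mathcal T$ with $t\psi=m$. *The Squier complex.* $\mathrm{Sq}(\mathcal P)$ is the $2$-complex with vertex set $\mathcal T$, an edge $(p,l,r,q)$ from $p(l\rho\tau)q$ to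 $p(r\rho\tau)q$ for all $p,q\in\mathcal T$ and $(l,r)\in\mathcal R$, and, for all $p,q,p',q'\in\mathcal T$ and $(l,r),(l',r')\in\mathcal R$, a $2$-cell attached along the square formed by the two paths $$(p,l,r,qp'(l'\rho\tau)q')\circ(p(r\rho\tau)qp',l',r',q')\quad\text{and}\quad(p(l\rho\tau)qp',l',r',q')\circ(p,l,r,qp'(r'\rho\tau)q').$$ Its fundamental groupoid $\pi$ on the vertex set $\mathcal T$, with domain and range maps $\mathbf d,\mathbf r$, has left and right actions of $\mathcal T$ induced by $t\rhd(p,l,r,q)=(tp,l,r,q)$ and $(p,l,r,q)\lhd t=(p,l,r,qt)$. Put $\alpha*\beta=(\alpha\lhd\beta\mathbf d)\circ(\alpha\mathbf r\rhd\beta)$. For an idempotent $e$ of $\mathcal T$, the set $\mathrm{star}_e^{\bowtie}=\{e\rhd\alpha\lhd e:\alpha\in\pi,\ \alpha\mathbf d=e\}$ is a group under $*$, $\mathbf r$ restricts to a homomorphism $\mathrm{star}_e^{\bowtie}\to K_e$, and $\pi_e^{\bowtie}=\{\alpha\in\mathrm{star}_e^{\bowtie}:\alpha\mathbf r=e\}$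 is an abelian subgroup. The maps $\alpha\mapsto t^{-1}\rhd\alpha\lhd t$, for any $t\in\mathcal T$ with $t\psi=m$, define the action of $m\in M$ that makes the module of identities $\bigsqcup_e\pi_e^{\bowtie}$ and $(S^{\bowtie})^{ab}=\bigsqcup_e(\mathrm{star}_e^{\bowtie})^{ab}$ into $M$-modules. **Theorem.** For every inverse monoid presentation $\mathcal P$ of an inverse monoid $M$ there is a short exact sequence of $M$-modules $$0\longrightarrow\bigsqcup_{e\in E(M)}\pi_e^{\bowtie}\longrightarrow(S^{\bowtie})^{ab}\xrightarrow{\ \overline{\mathbf r}\ }\mathcal K\longrightarrow0,$$ in which the first map is induced by the inclusions $\pi_e^{\bowtie}\subseteq\mathrm{star}_e^{\bowtie}$, the map $\overline{\mathbf r}$ is induced by the range maps $\mathbf r:\mathrm{star}_e^{\bowtie}\to K_e$, and $(S^{\bowtie})^{ab}$ is a free $M$-module. -/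

import Mathlib

universe u v w w' w''

/-! ### Inverse monoids -/

/-- An inverse monoid: every element `a` has a unique inverse `a⁻¹`, in the sense of semigroup
theory. -/
class InverseMonoid (S : Type u) extends Monoid S, Inv S where
  mul_inv_mul : ∀ a : S, a * a⁻¹ * a = a
  inv_mul_inv : ∀ a : S, a⁻¹ * a * a⁻¹ = a⁻¹
  inv_unique : ∀ a b : S, a * b * a = a → b * a * b = b → b = a⁻¹

namespace InverseMonoid

variable {S : Type u} [InverseMonoid S]

theorem inv_inv' (a : S) : a⁻¹⁻¹ = a :=
  (inv_unique a⁻¹ a (inv_mul_inv a) (mul_inv_mul a)).symm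

theorem idem_inv {e : S} (he : e * e = e) : e⁻¹ = e :=
  (inv_unique e e (by rw [he, he]) (by rw [he, he])).symm

theorem idem_mul {e f : S} (he : e * e = e) (hf : f * f = f) : e * f * (e * f) = e * f := by
  have h1 := mul_inv_mul (e * f)
  have h2 := inv_mul_inv (e * f)
  generalize hx : (e * f)⁻¹ = x at h1 h2
  have hy : f * x * e = x := by
    rw [← hx]
    refine inv_unique _ _ ?_ ?_ <;> rw [hx]
    · calc e * f * (f * x * e) * (e * f) = e * (f * f) * x * (e * e) * f := by
            simp only [mul_assoc]
        _ = e * f * x * (e * f) := by rw [he, hf]; simp only [mul_assoc]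
        _ = e * f := h1
    · calc f * x * e * (e * f) * (f * x * e) = f * x * (e * e) * (f * f) * x * e := by
            simp only [mul_assoc]
        _ = f * (x * (e * f) * x) * e := by rw [he, hf]; simp only [mul_assoc]
        _ = f * x * e := by rw [h2]
  have hxx : x * x = x := by
    calc x * x = f * x * e * (f * x * e) := by rw [hy]
      _ = f * (x * (e * f) * x) * e := by simp only [mul_assoc]
      _ = x := by rw [h2, hy]
  have : e * f = x := by
    rw [← inv_inv' (e * f), hx, idem_inv hxx]
  rw [this, hxx]

theorem idem_comm {e f : S} (he : e * e = e) (hf : f * f = f) : e * f = f * e := by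
  have h1 := idem_mul he hf
  have h2 := idem_mul hf he
  have : f * e = (e * f)⁻¹ := by
    refine inv_unique _ _ ?_ ?_
    · calc e * f * (f * e) * (e * f) = e * (f * f) * (e * e) * f := by simp only [mul_assoc]
        _ = e * f * (e * f) := by rw [he, hf]; simp only [mul_assoc]
        _ = e * f := h1
    · calc f * e * (e * f) * (f * e) = f * (e * e) * (f * f) * e := by simp only [mul_assoc]
        _ = f * e * (f * e) := by rw [he, hf]; simp only [mul_assoc]
        _ = f * e := h2
  rw [this, idem_inv h1]

theorem inv_mul_idem (a : S) : a⁻¹ * a * (a⁻¹ * a) = a⁻¹ * a := by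
  rw [← mul_assoc, inv_mul_inv]

theorem mul_inv_idem (a : S) : a * a⁻¹ * (a * a⁻¹) = a * a⁻¹ := by
  rw [← mul_assoc, mul_inv_mul]

theorem mul_inv_rev' (a b : S) : (a * b)⁻¹ = b⁻¹ * a⁻¹ := by
  have hc := idem_comm (mul_inv_idem b) (inv_mul_idem a)
  refine (inv_unique _ _ ?_ ?_).symm
  · calc a * b * (b⁻¹ * a⁻¹) * (a * b) = a * (b * b⁻¹ * (a⁻¹ * a)) * b := by
          simp only [mul_assoc]
      _ = a * a⁻¹ * a * (b * b⁻¹ * b) := by rw [hc]; simp only [mul_assoc]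
      _ = a * b := by rw [mul_inv_mul, mul_inv_mul]
  · calc b⁻¹ * a⁻¹ * (a * b) * (b⁻¹ * a⁻¹) = b⁻¹ * (a⁻¹ * a * (b * b⁻¹)) * a⁻¹ := by
          simp only [mul_assoc]
      _ = b⁻¹ * b * b⁻¹ * (a⁻¹ * a * a⁻¹) := by rw [← hc]; simp only [mul_assoc]
      _ = b⁻¹ * a⁻¹ := by rw [inv_mul_inv, inv_mul_inv]

theorem map_inv' {N : Type v} [InverseMonoid N] (f : S →* N) (a : S) : f a⁻¹ = (f a)⁻¹ :=
  inv_unique _ _ (by rw [← map_mul, ← map_mul, mul_inv_mul])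
    (by rw [← map_mul, ← map_mul, inv_mul_inv])

theorem conj_idem {e : S} (he : e * e = e) (s : S) :
    s⁻¹ * e * s * (s⁻¹ * e * s) = s⁻¹ * e * s := by
  calc s⁻¹ * e * s * (s⁻¹ * e * s) = s⁻¹ * (e * (s * s⁻¹)) * e * s := by simp only [mul_assoc]
    _ = s⁻¹ * s * s⁻¹ * (e * e) * s := by
        rw [idem_comm he (mul_inv_idem s)]; simp only [mul_assoc]
    _ = s⁻¹ * e * s := by rw [inv_mul_inv, he]

/-- Inverse monoids form the variety of monoids with an involution given by these identities. -/
abbrev ofIdentities (S : Type u) [Monoid S] [Inv S] (h1 : ∀ a : S, a * a⁻¹ * a = a)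
    (h2 : ∀ a : S, a⁻¹⁻¹ = a) (h3 : ∀ a b : S, (a * b)⁻¹ = b⁻¹ * a⁻¹)
    (h4 : ∀ a b : S, a * a⁻¹ * (b * b⁻¹) = b * b⁻¹ * (a * a⁻¹)) : InverseMonoid S where
  mul_inv_mul := h1
  inv_mul_inv a := by simpa only [h2] using h1 a⁻¹
  inv_unique a b hab hba := by
    have h5 : ∀ a : S, a⁻¹ * a * a⁻¹ = a⁻¹ := fun a => by simpa only [h2] using h1 a⁻¹
    have key : ∀ e : S, e * e = e → e = e * e⁻¹ := by
      intro e he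
      have hi : e⁻¹ * e⁻¹ = e⁻¹ := by rw [← h3, he]
      have : e = e⁻¹ := by
        calc e = e * (e⁻¹ * e⁻¹) * e := by rw [hi, h1]
          _ = e * e⁻¹ * (e⁻¹ * e⁻¹⁻¹) := by rw [h2]; simp only [mul_assoc]
          _ = e⁻¹ * (e * e) * e⁻¹ := by rw [h4, h2]; simp only [mul_assoc]
          _ = e⁻¹ := by rw [he, h5]
      rw [← this, he]
    have comm : ∀ e f : S, e * e = e → f * f = f → e * f = f * e := by
      intro e f he hf
      rw [key e he, key f hf, h4]
    have i1 : a * b * (a * b) = a * b := by rw [← mul_assoc, hab]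
    have i2 : b * a * (b * a) = b * a := by rw [← mul_assoc, hba]
    have i3 : a * a⁻¹ * (a * a⁻¹) = a * a⁻¹ := by rw [← mul_assoc, h1]
    have i4 : a⁻¹ * a * (a⁻¹ * a) = a⁻¹ * a := by rw [← mul_assoc, h5]
    calc b = b * (a * a⁻¹ * a) * b := by rw [h1, hba]
      _ = b * (a * a⁻¹ * (a * b)) := by simp only [mul_assoc]
      _ = b * (a * b * (a * a⁻¹)) := by rw [comm _ _ i3 i1]
      _ = (b * a * b) * (a * a⁻¹) := by simp only [mul_assoc]
      _ = b * a * (a⁻¹ * a) * a⁻¹ := by rw [hba, mul_assoc b a, mul_assoc (b) _ a⁻¹, mul_assoc a, h5]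
      _ = a⁻¹ * (a * b * a) * a⁻¹ := by rw [comm _ _ i2 i4]; simp only [mul_assoc]
      _ = a⁻¹ := by rw [hab, h5]

/-- A monoid congruence on an inverse monoid is compatible with inversion. -/
theorem con_inv (c : Con S) {a b : S} (h : c a b) : c a⁻¹ b⁻¹ := by
  have e : (a : c.Quotient) = b := c.eq.2 h
  rw [← c.eq]
  have x1 : ((a⁻¹ : S) : c.Quotient) * a * (a⁻¹ : S) = (a⁻¹ : S) := by
    rw [← Con.coe_mul, ← Con.coe_mul, inv_mul_inv]
  have y1 : ((b⁻¹ : S) : c.Quotient) * a * (b⁻¹ : S) = (b⁻¹ : S) := by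
    rw [e, ← Con.coe_mul, ← Con.coe_mul, inv_mul_inv]
  have x2 : (a : c.Quotient) * (a⁻¹ : S) * a = a := by
    rw [← Con.coe_mul, ← Con.coe_mul, mul_inv_mul]
  have y2 : (a : c.Quotient) * (b⁻¹ : S) * a = a := by
    rw [e, ← Con.coe_mul, ← Con.coe_mul, mul_inv_mul]
  have c1 : (a : c.Quotient) * (b⁻¹ : S) * (a * (a⁻¹ : S)) = a * (a⁻¹ : S) * (a * (b⁻¹ : S)) := by
    have := idem_comm (mul_inv_idem b) (mul_inv_idem a)
    have := congrArg (fun s : S => (s : c.Quotient)) this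
    simp only [Con.coe_mul] at this
    rwa [← e] at this
  have c2 : ((a⁻¹ : S) : c.Quotient) * a * ((b⁻¹ : S) * a) = (b⁻¹ : S) * a * ((a⁻¹ : S) * a) := by
    have := idem_comm (inv_mul_idem a) (inv_mul_idem b)
    have := congrArg (fun s : S => (s : c.Quotient)) this
    simp only [Con.coe_mul] at this
    rwa [← e] at this
  generalize ((a⁻¹ : S) : c.Quotient) = x at *
  generalize ((b⁻¹ : S) : c.Quotient) = y at *
  generalize (a : c.Quotient) = z at *
  calc x = x * (z * y * z) * x := by rw [y2, x1]
    _ = x * (z * y * (z * x)) := by simp only [mul_assoc]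
    _ = x * z * x * (z * y) := by rw [c1]; simp only [mul_assoc]
    _ = x * z * (y * z * y) := by rw [x1, y1, mul_assoc]
    _ = x * z * (y * z) * y := by simp only [mul_assoc]
    _ = y * (z * x * z) * y := by rw [c2]; simp only [mul_assoc]
    _ = y := by rw [x2, y1]

instance (c : Con S) : Inv c.Quotient :=
  ⟨Quotient.map' (fun a => a⁻¹) fun _ _ h => con_inv c h⟩

/-- A quotient of an inverse monoid is an inverse monoid. -/
instance quotient (c : Con S) : InverseMonoid c.Quotient :=
  ofIdentities c.Quotient
    (by rintro ⟨a⟩; exact congrArg (fun s : S => (s : c.Quotient)) (mul_inv_mul a))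
    (by rintro ⟨a⟩; exact congrArg (fun s : S => (s : c.Quotient)) (inv_inv' a))
    (by rintro ⟨a⟩ ⟨b⟩; exact congrArg (fun s : S => (s : c.Quotient)) (mul_inv_rev' a b))
    (by
      rintro ⟨a⟩ ⟨b⟩
      exact congrArg (fun s : S => (s : c.Quotient)) (idem_comm (mul_inv_idem a) (mul_inv_idem b)))

end InverseMonoid

section Modules

open InverseMonoid

/-- The idempotents `E(S)` of an inverse monoid. -/
structure Idem (S : Type u) [InverseMonoid S] : Type u where
  val : S
  idem : val * val = val

namespace Idem

variable {S : Type u} [InverseMonoid S]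

attribute [ext] Idem

instance : Mul (Idem S) := ⟨fun e f => ⟨e.val * f.val, idem_mul e.idem f.idem⟩⟩

/-- The natural partial order on idempotents. -/
instance : LE (Idem S) := ⟨fun f e => f.val = e.val * f.val⟩

theorem le_def {e f : Idem S} : f ≤ e ↔ f.val = e.val * f.val := Iff.rfl

theorem coe_mul (e f : Idem S) : (e * f).val = e.val * f.val := rfl

protected theorem le_refl (e : Idem S) : e ≤ e := e.idem.symm

protected theorem le_trans {e f g : Idem S} (h1 : g ≤ f) (h2 : f ≤ e) : g ≤ e := by
  rw [le_def] at *
  rw [h1, ← mul_assoc, ← h2]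

theorem mul_le_left (e f : Idem S) : e * f ≤ e := by
  rw [le_def, coe_mul, ← mul_assoc, e.idem]

theorem mul_le_right (e f : Idem S) : e * f ≤ f := by
  rw [le_def, coe_mul, idem_comm e.idem f.idem, ← mul_assoc, f.idem]

/-- The idempotent `s⁻¹es`. -/
def conj (e : Idem S) (s : S) : Idem S := ⟨s⁻¹ * e.val * s, conj_idem e.idem s⟩

/-- The idempotent `ss⁻¹`. -/
def dom (s : S) : Idem S := ⟨s * s⁻¹, mul_inv_idem s⟩

/-- The idempotent `s⁻¹s`. -/
def ran (s : S) : Idem S := ⟨s⁻¹ * s, inv_mul_idem s⟩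

end Idem

/-! ### Lausch modules -/

/-- A presheaf of abelian groups over the semilattice `E(S)`. -/
structure AbPresheaf (S : Type u) [InverseMonoid S] where
  carrier : Idem S → Type w
  grp : ∀ e, AddCommGroup (carrier e)
  res : ∀ {e f : Idem S}, f ≤ e → carrier e →+ carrier f
  res_self : ∀ {e : Idem S} (h : e ≤ e) (a : carrier e), res h a = a
  res_res : ∀ {e f g : Idem S} (h1 : f ≤ e) (h2 : g ≤ f) (h3 : g ≤ e) (a : carrier e),
    res h2 (res h1 a) = res h3 a

attribute [instance] AbPresheaf.grp

namespace AbPresheaf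

variable {S : Type u} [InverseMonoid S] (A : AbPresheaf.{u, w} S)

/-- The disjoint union of the groups `A_e`. -/
abbrev Total : Type (max u w) := Σ e : Idem S, A.carrier e

/-- The operation `a ⊕ b` of the commutative Clifford semigroup `⊔ A_e`. -/
def oplus (a b : A.Total) : A.Total :=
  ⟨a.1 * b.1, A.res (Idem.mul_le_left a.1 b.1) a.2 + A.res (Idem.mul_le_right a.1 b.1) b.2⟩

/-- The element `0_e`. -/
def zeroAt (e : Idem S) : A.Total := ⟨e, 0⟩

end AbPresheaf

/-- A module, in the sense of Lausch, for an inverse monoid `S`. -/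
structure LauschModule (S : Type u) [InverseMonoid S] extends AbPresheaf.{u, w} S where
  act : toAbPresheaf.Total → S → toAbPresheaf.Total
  act_oplus : ∀ a b s,
    act (toAbPresheaf.oplus a b) s = toAbPresheaf.oplus (act a s) (act b s)
  act_mul : ∀ a s t, act a (s * t) = act (act a s) t
  act_idem : ∀ a (e : Idem S), act a e.val = toAbPresheaf.oplus a (toAbPresheaf.zeroAt e)
  act_zero : ∀ e s, act (toAbPresheaf.zeroAt e) s = toAbPresheaf.zeroAt (e.conj s)

namespace LauschModule

variable {S : Type u} [InverseMonoid S]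

/-- A homomorphism of `S`-modules: homomorphisms `A_e → B_e` that commute with the structure maps
and with the action of `S`. -/
structure Hom (A : LauschModule.{u, w} S) (B : LauschModule.{u, w'} S) where
  app : ∀ e, A.carrier e →+ B.carrier e
  map_res : ∀ {e f : Idem S} (h : f ≤ e) (a : A.carrier e),
    app f (A.res h a) = B.res h (app e a)
  map_act : ∀ (a : A.toAbPresheaf.Total) (s : S),
    (⟨(A.act a s).1, app _ (A.act a s).2⟩ : B.toAbPresheaf.Total) = B.act ⟨a.1, app _ a.2⟩ s

/-- Two modules are isomorphic if there is a homomorphism between them that is bijective. -/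
def Isomorphic (A : LauschModule.{u, w} S) (B : LauschModule.{u, w'} S) : Prop :=
  ∃ φ : Hom A B, ∀ e, Function.Bijective (φ.app e)

/-- Exactness of `0 → A → B → C → 0`. -/
structure ShortExact {A : LauschModule.{u, w} S} {B : LauschModule.{u, w'} S}
    {C : LauschModule.{u, v} S} (f : Hom A B) (g : Hom B C) : Prop where
  injective : ∀ e, Function.Injective (f.app e)
  exact : ∀ e, Function.Exact (f.app e) (g.app e)
  surjective : ∀ e, Function.Surjective (g.app e)

end LauschModule

/-- The action of `S` on a Lausch module, written as a family of homomorphisms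
`A_e → A_f`, where `f = s⁻¹es`. The structure maps are then given by the action of idempotents. -/
structure GradedAction (S : Type u) [InverseMonoid S] (A : Idem S → Type w)
    [∀ e, AddCommGroup (A e)] where
  act : ∀ (s : S) {e f : Idem S}, f.val = s⁻¹ * e.val * s → (A e →+ A f)
  act_mul : ∀ (s t : S) {e f g : Idem S} (h1 : f.val = s⁻¹ * e.val * s) (h2 : g.val = t⁻¹ * f.val * t)
    (h3 : g.val = (s * t)⁻¹ * e.val * (s * t)) (a : A e), act (s * t) h3 a = act t h2 (act s h1 a)
  act_self : ∀ (e : Idem S) (h : e.val = e.val⁻¹ * e.val * e.val) (a : A e), act e.val h a = a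

namespace GradedAction

variable {S : Type u} [InverseMonoid S] {A : Idem S → Type w} [∀ e, AddCommGroup (A e)]

theorem le_conj {e f : Idem S} (h : f ≤ e) : f.val = f.val⁻¹ * e.val * f.val := by
  rw [idem_inv f.idem, mul_assoc, ← Idem.le_def.1 h, f.idem]

theorem act_congr (α : GradedAction S A) {s t : S} (hst : s = t) {e f f' : Idem S} (hf : f = f')
    (h : f.val = s⁻¹ * e.val * s) (h' : f'.1 = t⁻¹ * e.val * t) (a : A e) :
    (⟨f, α.act s h a⟩ : Σ e, A e) = ⟨f', α.act t h' a⟩ := by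
  subst hst hf; rfl

theorem act_of_eq (α : GradedAction S A) {s t : S} {e f : Idem S} (hst : e.val * s = e.val * t)
    (h : f.val = s⁻¹ * e.val * s) (h' : f.val = t⁻¹ * e.val * t) (a : A e) :
    α.act s h a = α.act t h' a := by
  have he : e.val = e.val⁻¹ * e.val * e.val := by rw [idem_inv e.idem, e.idem, e.idem]
  have key : ∀ (r : S) (hr : f.val = r⁻¹ * e.val * r) (hr' : f.val = (e.val * r)⁻¹ * e.val * (e.val * r)),
      α.act r hr a = α.act (e.val * r) hr' a := by
    intro r hr hr'
    rw [α.act_mul e.val r he hr hr', α.act_self]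
  have h2 : ∀ (r : S) (hr : f.val = r⁻¹ * e.val * r), f.val = (e.val * r)⁻¹ * e.val * (e.val * r) := by
    intro r hr
    rw [hr, mul_inv_rev', idem_inv e.idem]
    calc r⁻¹ * e.val * r = r⁻¹ * (e.val * e.val * e.val) * r := by rw [e.idem, e.idem]
      _ = _ := by simp only [mul_assoc]
  rw [key s h (h2 s h), key t h' (h2 t h')]
  have := α.act_congr hst rfl (h2 s h) (h2 t h') a
  simpa only [Sigma.mk.injEq, heq_eq_eq, true_and] using this

theorem conj_mul (e f : Idem S) (s : S) : (e * f).conj s = e.conj s * f.conj s := by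
  ext
  simp only [Idem.conj, Idem.coe_mul]
  calc s⁻¹ * (e.val * f.val) * s = s⁻¹ * s * s⁻¹ * e.val * f.val * s := by
        rw [inv_mul_inv]; simp only [mul_assoc]
    _ = s⁻¹ * (s * s⁻¹ * e.val) * f.val * s := by simp only [mul_assoc]
    _ = _ := by rw [idem_comm (mul_inv_idem s) e.idem]; simp only [mul_assoc]

theorem act_res (α : GradedAction S A) {e f g g' : Idem S} (h : g ≤ e) (s : S)
    (hf : f.val = s⁻¹ * e.val * s) (h' : g' ≤ f) (hg : g'.val = s⁻¹ * g.val * s) (a : A e) :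
    α.act s hg (α.act g.val (le_conj h) a) = α.act g'.val (le_conj h') (α.act s hf a) := by
  have hs : s * g'.val = g.val * s := by
    rw [hg]
    calc s * (s⁻¹ * g.val * s) = s * s⁻¹ * g.val * s := by simp only [mul_assoc]
      _ = _ := by rw [idem_comm (mul_inv_idem s) g.idem, mul_assoc, mul_inv_mul]
  have h1 : g'.val = (g.val * s)⁻¹ * e.val * (g.val * s) := by
    rw [mul_inv_rev', hg]
    conv_lhs => rw [le_conj h]
    simp only [mul_assoc]
  rw [← α.act_mul _ _ _ _ h1, ← α.act_mul _ _ _ _ (by rw [hs]; exact h1)]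
  exact α.act_of_eq (by rw [hs]) _ _ a

/-- The Lausch module given by a graded action. -/
def toModule (α : GradedAction S A) : LauschModule.{u, w} S where
  carrier := A
  grp := inferInstance
  res {e f} h := α.act f.val (le_conj h)
  res_self {e} _ a := α.act_self e _ a
  res_res {e f g} h1 h2 h3 a := by
    rw [← α.act_mul f.val g.val (le_conj h1) (le_conj h2)]
    · refine α.act_of_eq ?_ _ _ a
      rw [← h2]
    · rw [← Idem.le_def.1 h2]; exact le_conj h3
  act a s := ⟨a.1.conj s, α.act s rfl a.2⟩
  act_oplus := by
    rintro ⟨e, a⟩ ⟨f, b⟩ s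
    have gen : ∀ (g : Idem S) (_ : g = e.conj s * f.conj s) (h0 : g.val = s⁻¹ * (e * f).val * s),
        (⟨g, α.act s h0 (α.act (e * f).val (le_conj (Idem.mul_le_left e f)) a +
            α.act (e * f).val (le_conj (Idem.mul_le_right e f)) b)⟩ : Σ e, A e) =
          ⟨e.conj s * f.conj s,
            α.act (e.conj s * f.conj s).val (le_conj (Idem.mul_le_left _ _)) (α.act s rfl a) +
            α.act (e.conj s * f.conj s).val (le_conj (Idem.mul_le_right _ _)) (α.act s rfl b)⟩ := by
      intro g hg h0
      subst hg
      rw [map_add, α.act_res (Idem.mul_le_left e f) s rfl (Idem.mul_le_left _ _) h0,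
        α.act_res (Idem.mul_le_right e f) s rfl (Idem.mul_le_right _ _) h0]
    exact gen _ (conj_mul e f s) rfl
  act_mul := by
    rintro ⟨e, a⟩ s t
    have hE : e.conj (s * t) = (e.conj s).conj t := by
      ext; simp only [Idem.conj, mul_inv_rev', mul_assoc]
    have h3 : ((e.conj s).conj t).1 = (s * t)⁻¹ * e.val * (s * t) := by rw [← hE]; rfl
    change (⟨e.conj (s * t), α.act (s * t) rfl a⟩ : Σ e, A e) =
      ⟨(e.conj s).conj t, α.act t rfl (α.act s rfl a)⟩
    rw [← α.act_mul s t rfl rfl h3]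
    exact α.act_congr rfl hE _ _ a
  act_idem := by
    rintro ⟨e, a⟩ f
    have hE : e.conj f.val = e * f := by
      ext
      simp only [Idem.conj, Idem.coe_mul]
      rw [idem_inv f.idem, idem_comm f.idem e.idem, mul_assoc, f.idem]
    have h' : (e * f).val = f.val⁻¹ * e.val * f.val := by rw [← hE]; rfl
    change (⟨e.conj f.val, α.act f.val rfl a⟩ : Σ e, A e) =
      ⟨e * f, α.act (e * f).val (le_conj (Idem.mul_le_left e f)) a +
        α.act (e * f).val (le_conj (Idem.mul_le_right e f)) 0⟩
    rw [map_zero, add_zero,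
      α.act_of_eq (t := f.val) (by rw [Idem.coe_mul, ← mul_assoc, e.idem]) _ h' a]
    exact α.act_congr rfl hE _ _ a
  act_zero := by
    intro e s
    change (⟨e.conj s, α.act s rfl 0⟩ : Σ e, A e) = ⟨e.conj s, 0⟩
    rw [map_zero]

end GradedAction

namespace LauschModule

variable {S : Type u} [InverseMonoid S]

/-- The basis `{(b, s) : b ∈ B_f, f ≥ ss⁻¹, s⁻¹s = e}` of the group `F_e` of the free module on
the family of sets `B`. -/
@[ext] structure FreeBasis (B : Idem S → Type w) (e : Idem S) : Type (max u w) where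
  gen : Σ f : Idem S, B f
  elt : S
  dom_le : Idem.dom elt ≤ gen.1
  ran_eq : Idem.ran elt = e

/-- The map `(b, s) ↦ (b, st)`. -/
def FreeBasis.act {B : Idem S → Type w} (t : S) {e f : Idem S} (h : f.val = t⁻¹ * e.val * t)
    (x : FreeBasis B e) : FreeBasis B f where
  gen := x.gen
  elt := x.elt * t
  dom_le := by
    refine Idem.le_trans (f := Idem.dom x.elt) ?_ x.dom_le
    rw [Idem.le_def]
    simp only [Idem.dom]
    rw [← mul_assoc, ← mul_assoc, mul_inv_mul]
  ran_eq := by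
    ext
    have hv : e.val = x.elt⁻¹ * x.elt := congrArg Idem.val x.ran_eq.symm
    rw [h, hv]
    simp only [Idem.ran, mul_inv_rev', mul_assoc]

/-- The action of the free module: `(b, s) ◁ t = (b, st)`. -/
def freeAction (B : Idem S → Type w) :
    GradedAction S fun e => FreeAbelianGroup (FreeBasis B e) where
  act t {_ _} h := FreeAbelianGroup.map (FreeBasis.act t h)
  act_mul s t {e f g} h1 h2 h3 a := by
    rw [← FreeAbelianGroup.map_comp_apply]
    congr 2
    funext x
    exact FreeBasis.ext rfl (mul_assoc _ _ _).symm
  act_self e h a := by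
    have : FreeBasis.act (B := B) e.val h = id := by
      funext x
      refine FreeBasis.ext rfl ?_
      change x.elt * e.val = x.elt
      have hv : e.val = x.elt⁻¹ * x.elt := congrArg Idem.val x.ran_eq.symm
      rw [hv, ← mul_assoc, mul_inv_mul]
    rw [this, FreeAbelianGroup.map_id_apply]

/-- The free `S`-module on the family of sets `B`. -/
def free (B : Idem S → Type w) : LauschModule.{u, max u w} S := (freeAction B).toModule

/-- A module is free if it is isomorphic to the free module on some family of sets. -/
def IsFree (A : LauschModule.{u, w'} S) : Prop :=
  ∃ B : Idem S → Type w, Isomorphic A (free B)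

end LauschModule

/-! ### The free inverse monoid -/

/-- The inverse of a word over the alphabet `A = X ⊔ X⁻¹`, where `(x, true)` is the letter `x` and
`(x, false)` is the letter `x⁻¹`. -/
def invWord {X : Type u} (w : FreeMonoid (X × Bool)) : FreeMonoid (X × Bool) :=
  FreeMonoid.ofList (FreeGroup.invRev (FreeMonoid.toList w))

theorem invWord_mul {X : Type u} (v w : FreeMonoid (X × Bool)) :
    invWord (v * w) = invWord w * invWord v :=
  FreeGroup.invRev_append

theorem invWord_invWord {X : Type u} (w : FreeMonoid (X × Bool)) : invWord (invWord w) = w :=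
  FreeGroup.invRev_invRev

/-- The defining relations of the Wagner congruence. -/
inductive WagnerRel (X : Type u) : FreeMonoid (X × Bool) → FreeMonoid (X × Bool) → Prop
  | regular (w : FreeMonoid (X × Bool)) : WagnerRel X (w * invWord w * w) w
  | commute (v w : FreeMonoid (X × Bool)) :
      WagnerRel X (v * invWord v * (w * invWord w)) (w * invWord w * (v * invWord v))

/-- The Wagner congruence on the free monoid on `X ⊔ X⁻¹`. -/
def wagnerCon (X : Type u) : Con (FreeMonoid (X × Bool)) := conGen (WagnerRel X)

theorem wagnerCon_inv {X : Type u} {v w : FreeMonoid (X × Bool)} (h : wagnerCon X v w) :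
    wagnerCon X (invWord v) (invWord w) := by
  have h' : ConGen.Rel (WagnerRel X) v w := h
  change ConGen.Rel (WagnerRel X) (invWord v) (invWord w)
  induction h' with
  | of x y hxy =>
    cases hxy with
    | regular =>
      have := ConGen.Rel.of _ _ (WagnerRel.regular (invWord y))
      simpa only [invWord_mul, invWord_invWord, mul_assoc] using this
    | commute a b =>
      have := ConGen.Rel.of _ _ (WagnerRel.commute b a)
      simpa only [invWord_mul, invWord_invWord, mul_assoc] using this
  | refl x => exact ConGen.Rel.refl _
  | symm h1 ih => exact (ih h1).symm
  | trans h1 h2 ih1 ih2 => exact (ih1 h1).trans (ih2 h2)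
  | mul h1 h2 ih1 ih2 =>
    rw [invWord_mul, invWord_mul]
    exact (ih2 h2).mul (ih1 h1)

/-- The free inverse monoid on `X`. -/
def FIM (X : Type u) : Type u := (wagnerCon X).Quotient

namespace FIM

instance (X : Type u) : Monoid (FIM X) := inferInstanceAs (Monoid (wagnerCon X).Quotient)

instance (X : Type u) : Inv (FIM X) :=
  ⟨Quotient.map' (s₁ := (wagnerCon X).toSetoid) (s₂ := (wagnerCon X).toSetoid) invWord
    fun _ _ h => wagnerCon_inv h⟩

/-- The canonical map `ρ` from words to the free inverse monoid. -/
def ofWord {X : Type u} : FreeMonoid (X × Bool) →* FIM X := (wagnerCon X).mk'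

theorem ofWord_surjective {X : Type u} : Function.Surjective (ofWord (X := X)) :=
  (wagnerCon X).mk'_surjective

theorem ofWord_inv {X : Type u} (w : FreeMonoid (X × Bool)) : (ofWord w)⁻¹ = ofWord (invWord w) :=
  rfl

theorem ofWord_eq {X : Type u} {v w : FreeMonoid (X × Bool)} (h : WagnerRel X v w) :
    ofWord v = ofWord w :=
  (wagnerCon X).eq.2 (ConGen.Rel.of _ _ h)

instance (X : Type u) : InverseMonoid (FIM X) :=
  ofIdentities (FIM X)
    (fun a => by
      obtain ⟨w, rfl⟩ := ofWord_surjective a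
      rw [ofWord_inv, ← map_mul, ← map_mul]
      exact ofWord_eq (.regular w))
    (fun a => by
      obtain ⟨w, rfl⟩ := ofWord_surjective a
      rw [ofWord_inv, ofWord_inv, invWord_invWord])
    (fun a b => by
      obtain ⟨v, rfl⟩ := ofWord_surjective a
      obtain ⟨w, rfl⟩ := ofWord_surjective b
      rw [← map_mul, ofWord_inv, ofWord_inv, ofWord_inv, invWord_mul, map_mul])
    (fun a b => by
      obtain ⟨v, rfl⟩ := ofWord_surjective a
      obtain ⟨w, rfl⟩ := ofWord_surjective b
      simp only [ofWord_inv, ← map_mul]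
      exact ofWord_eq (.commute v w))

end FIM

/-! ### The minimal congruence with the trace of a given homomorphism -/

section MinCon

variable {S : Type u} {M : Type v} [InverseMonoid S] [InverseMonoid M] (θ : S →* M)

/-- `a` and `b` are related if there is an idempotent `e` with `ae = be` whose image under `θ` is
the image of `a⁻¹a` and of `b⁻¹b`. -/
def MinRel (a b : S) : Prop :=
  ∃ e : Idem S, a * e.val = b * e.val ∧ θ (a⁻¹ * a) = θ e.val ∧ θ e.val = θ (b⁻¹ * b)

theorem MinRel.map_eq {θ : S →* M} {a b : S} (h : MinRel θ a b) : θ a = θ b := by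
  obtain ⟨e, h1, h2, h3⟩ := h
  calc θ a = θ (a * (a⁻¹ * a)) := by rw [← mul_assoc, mul_inv_mul]
    _ = θ (b * e.val) := by rw [map_mul, h2, ← map_mul, h1]
    _ = θ (b * (b⁻¹ * b)) := by rw [map_mul, h3, ← map_mul]
    _ = θ b := by rw [← mul_assoc, mul_inv_mul]

/-- The smallest congruence `θ_min` with the same trace as the congruence induced by `θ`. -/
def minCon : Con S where
  r := MinRel θ
  iseqv :=
    { refl := fun a => ⟨Idem.ran a, rfl, rfl, rfl⟩
      symm := fun ⟨e, h1, h2, h3⟩ => ⟨e, h1.symm, h3.symm, h2.symm⟩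
      trans := by
        rintro a b c ⟨e, h1, h2, h3⟩ ⟨f, k1, k2, k3⟩
        have hef : θ (e * f).val = θ e.val := by
          rw [Idem.coe_mul, map_mul, ← k2, ← h3, ← map_mul, e.idem]
        refine ⟨e * f, ?_, ?_, ?_⟩
        · rw [Idem.coe_mul, ← mul_assoc, h1, mul_assoc, idem_comm e.idem f.idem, ← mul_assoc, k1,
            mul_assoc]
        · rw [hef, h2]
        · rw [hef, h3, k2, k3] }
  mul' := by
    rintro a b c d hab hcd
    have hθ : θ c = θ d := hcd.map_eq
    have hθ' : θ a = θ b := hab.map_eq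
    obtain ⟨e, h1, h2, h3⟩ := hab
    obtain ⟨f, k1, k2, k3⟩ := hcd
    have hg : c * (e.conj c * f).val = e.val * c * f.val := by
      calc c * (c⁻¹ * e.val * c * f.val) = c * c⁻¹ * e.val * c * f.val := by
            simp only [mul_assoc]
        _ = e.val * (c * c⁻¹ * c) * f.val := by
            rw [idem_comm (mul_inv_idem c) e.idem]; simp only [mul_assoc]
        _ = _ := by rw [mul_inv_mul]
    have hg' : d * (e.conj c * f).val = e.val * c * f.val := by
      rw [Idem.coe_mul, idem_comm (e.conj c).idem f.idem, ← mul_assoc, ← k1, mul_assoc,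
        idem_comm f.idem (e.conj c).idem, ← Idem.coe_mul, hg]
    have hv : θ (e.conj c * f).val = θ ((a * c)⁻¹ * (a * c)) := by
      rw [mul_inv_rev']
      calc θ (c⁻¹ * e.val * c * f.val) = θ c⁻¹ * θ (a⁻¹ * a) * θ (c * (c⁻¹ * c)) := by
            simp only [map_mul, ← k2, ← h2, mul_assoc]
        _ = _ := by
            rw [← mul_assoc c, mul_inv_mul]; simp only [map_mul, mul_assoc]
    refine ⟨e.conj c * f, ?_, hv.symm, ?_⟩
    · rw [mul_assoc a, hg, mul_assoc b, hg', mul_assoc e.val, ← mul_assoc a, ← mul_assoc b, h1]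
    · rw [hv]
      simp only [map_mul, map_inv', hθ, hθ']

end MinCon

/-! ### Presentations of inverse monoids -/

/-- A presentation of the inverse monoid `M` with generating set `X`: a set of pairs of words over
`X ⊔ X⁻¹` and a surjective homomorphism from the free inverse monoid to `M` that induces the
congruence generated by these pairs. -/
structure InvPresentation (X : Type u) (M : Type v) [InverseMonoid M] where
  rels : Set (FreeMonoid (X × Bool) × FreeMonoid (X × Bool))
  θ : FIM X →* M
  surjective : Function.Surjective θ
  ker_eq : Con.ker θ =
    conGen fun a b => ∃ p ∈ rels, a = FIM.ofWord p.1 ∧ b = FIM.ofWord p.2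

/-- An idempotent separating quotient map `ψ : T → M` of inverse monoids, together with a family of
relations `lhs i = rhs i` between elements of `T` that generates the congruence of `ψ`. -/
structure SepQuotient (ι : Type w) (T : Type u) (M : Type v) [InverseMonoid T]
    [InverseMonoid M] where
  ψ : T →* M
  surjective : Function.Surjective ψ
  separating : ∀ e f : Idem T, ψ e.val = ψ f.val → e = f
  lhs : ι → T
  rhs : ι → T
  ker_eq : Con.ker ψ = conGen fun a b => ∃ i, a = lhs i ∧ b = rhs i

namespace InvPresentation

variable {X : Type u} {M : Type v} [InverseMonoid M] (P : InvPresentation X M)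

/-- The inverse monoid `𝒯(M, X) = FIM(X) / θ_min`. -/
abbrev T : Type u := (minCon P.θ).Quotient

/-- The map `τ : FIM(X) → 𝒯(M, X)`. -/
def τ : FIM X →* P.T := (minCon P.θ).mk'

/-- The idempotent separating map `ψ : 𝒯(M, X) → M`. -/
def ψ : P.T →* M := (minCon P.θ).lift P.θ fun _ _ h => MinRel.map_eq h

theorem τ_surjective : Function.Surjective P.τ := (minCon P.θ).mk'_surjective

theorem ψ_τ (a : FIM X) : P.ψ (P.τ a) = P.θ a := rfl

/-- The map `ψ : 𝒯(M, X) → M` and the relations of the presentation, read in `𝒯(M, X)`. -/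
def sep : SepQuotient P.rels P.T M where
  ψ := P.ψ
  surjective m := by
    obtain ⟨a, rfl⟩ := P.surjective m
    exact ⟨P.τ a, rfl⟩
  separating := by
    have key : ∀ e : Idem P.T, ∃ a : FIM X, e.val = P.τ (a⁻¹ * a) := by
      intro e
      obtain ⟨a, ha⟩ := P.τ_surjective e.val
      refine ⟨a, ?_⟩
      rw [map_mul, map_inv', ha, idem_inv e.idem, e.idem]
    intro e f h
    obtain ⟨a, ha⟩ := key e
    obtain ⟨b, hb⟩ := key f
    have hab : P.θ (a⁻¹ * a) = P.θ (b⁻¹ * b) := by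
      rw [ha, hb, P.ψ_τ, P.ψ_τ] at h; exact h
    ext
    rw [ha, hb]
    refine (minCon P.θ).eq.2 ?_
    have ia : (a⁻¹ * a)⁻¹ * (a⁻¹ * a) = a⁻¹ * a := by rw [idem_inv (inv_mul_idem a), inv_mul_idem]
    have ib : (b⁻¹ * b)⁻¹ * (b⁻¹ * b) = b⁻¹ * b := by rw [idem_inv (inv_mul_idem b), inv_mul_idem]
    refine ⟨Idem.ran a * Idem.ran b, ?_, ?_, ?_⟩
    · simp only [Idem.coe_mul, Idem.ran]
      rw [← mul_assoc (a⁻¹ * a) (a⁻¹ * a), inv_mul_idem,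
        idem_comm (inv_mul_idem a) (inv_mul_idem b),
        ← mul_assoc (b⁻¹ * b) (b⁻¹ * b), inv_mul_idem]
    · rw [ia, Idem.coe_mul]
      simp only [Idem.ran]
      rw [map_mul P.θ (a⁻¹ * a), ← hab, ← map_mul, inv_mul_idem]
    · rw [ib, Idem.coe_mul]
      simp only [Idem.ran]
      rw [map_mul P.θ (a⁻¹ * a), hab, ← map_mul, inv_mul_idem]
  lhs p := P.τ (FIM.ofWord p.1.1)
  rhs p := P.τ (FIM.ofWord p.1.2)
  ker_eq := by
    refine le_antisymm ?_ ?_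
    · intro x y h
      obtain ⟨a, rfl⟩ := P.τ_surjective x
      obtain ⟨b, rfl⟩ := P.τ_surjective y
      have hab : Con.ker P.θ a b := h
      rw [P.ker_eq] at hab
      have hle : (conGen fun a b => ∃ p ∈ P.rels, a = FIM.ofWord p.1 ∧ b = FIM.ofWord p.2) ≤
          Con.comap P.τ P.τ.map_mul (conGen fun a b => ∃ p : P.rels,
            a = P.τ (FIM.ofWord p.1.1) ∧ b = P.τ (FIM.ofWord p.1.2)) := by
        rw [Con.conGen_le]
        rintro _ _ ⟨p, hp, rfl, rfl⟩
        exact ConGen.Rel.of _ _ ⟨⟨p, hp⟩, rfl, rfl⟩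
      exact hle hab
    · rw [Con.conGen_le]
      rintro _ _ ⟨p, rfl, rfl⟩
      change P.θ (FIM.ofWord p.1.1) = P.θ (FIM.ofWord p.1.2)
      have : Con.ker P.θ (FIM.ofWord p.1.1) (FIM.ofWord p.1.2) := by
        rw [P.ker_eq]
        exact ConGen.Rel.of _ _ ⟨p.1, p.2, rfl, rfl⟩
      exact this

end InvPresentation

namespace SepQuotient

variable {ι : Type w} {T : Type u} {M : Type v} [InverseMonoid T] [InverseMonoid M]
  (Q : SepQuotient ι T M)

theorem idem_eq {a b : T} (ha : a * a = a) (hb : b * b = b) (h : Q.ψ a = Q.ψ b) : a = b :=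
  congrArg Idem.val (Q.separating ⟨a, ha⟩ ⟨b, hb⟩ h)

theorem mul_inv_eq {a b : T} (h : Q.ψ a = Q.ψ b) : a * a⁻¹ = b * b⁻¹ :=
  Q.idem_eq (mul_inv_idem a) (mul_inv_idem b) (by simp only [map_mul, map_inv', h])

theorem inv_mul_eq {a b : T} (h : Q.ψ a = Q.ψ b) : a⁻¹ * a = b⁻¹ * b :=
  Q.idem_eq (inv_mul_idem a) (inv_mul_idem b) (by simp only [map_mul, map_inv', h])

theorem mul_inv_of_ker {e : Idem T} {a : T} (h : Q.ψ a = Q.ψ e.val) : a * a⁻¹ = e.val := by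
  rw [Q.mul_inv_eq h, idem_inv e.idem, e.idem]

theorem inv_mul_of_ker {e : Idem T} {a : T} (h : Q.ψ a = Q.ψ e.val) : a⁻¹ * a = e.val := by
  rw [Q.inv_mul_eq h, idem_inv e.idem, e.idem]

theorem idem_mul_of_ker {e : Idem T} {a : T} (h : Q.ψ a = Q.ψ e.val) : e.val * a = a := by
  rw [← Q.mul_inv_of_ker h, mul_inv_mul]

theorem mul_idem_of_ker {e : Idem T} {a : T} (h : Q.ψ a = Q.ψ e.val) : a * e.val = a := by
  rw [← Q.inv_mul_of_ker h, ← mul_assoc, mul_inv_mul]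

theorem ker_comm {e : Idem T} {a : T} (h : Q.ψ a = Q.ψ e.val) {f : T}
    (hf : f * f = f) : a * f = f * a := by
  have h1 : a * f * a⁻¹ = e.val * f := by
    refine Q.idem_eq ?_ (idem_mul e.idem hf) ?_
    · have := conj_idem hf a⁻¹
      rwa [inv_inv'] at this
    · have : e.val * f * e.val = e.val * f := by
        rw [mul_assoc, ← idem_comm e.idem hf, ← mul_assoc, e.idem]
      rw [← this]
      simp only [map_mul, map_inv', h]
      rw [← map_inv', idem_inv e.idem]
  calc a * f = a * (a⁻¹ * a * f) := by rw [← mul_assoc, ← mul_assoc, mul_inv_mul]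
    _ = a * f * a⁻¹ * a := by rw [idem_comm (inv_mul_idem a) hf]; simp only [mul_assoc]
    _ = f * a := by rw [h1, idem_comm e.idem hf, mul_assoc, Q.idem_mul_of_ker h]

/-- The unique idempotent of `T` over an idempotent of `M`. -/
noncomputable def lift (e : Idem M) : Idem T := Idem.ran (Classical.choose (Q.surjective e.val))

theorem ψ_lift (e : Idem M) : Q.ψ (Q.lift e).val = e.val := by
  change Q.ψ ((Classical.choose (Q.surjective e.val))⁻¹ * _) = _
  rw [map_mul, map_inv', Classical.choose_spec (Q.surjective e.val), idem_inv e.idem, e.idem]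

/-- A chosen element of `T` over an element of `M`. -/
noncomputable def pick (m : M) : T := Classical.choose (Q.surjective m)

theorem ψ_pick (m : M) : Q.ψ (Q.pick m) = m := Classical.choose_spec (Q.surjective m)

/-- A `T`-action that depends only on the images in `M` of the elements of `T` makes the groups
`A_e`, indexed by the idempotents of `M`, into an `M`-module, in which `a ◁ m = a ◁ t` for any `t`
over `m`. -/
noncomputable def descend {A : Idem T → Type w'} [∀ e, AddCommGroup (A e)] (α : GradedAction T A)
    (hα : ∀ (s t : T) {e f : Idem T} (hs : f.val = s⁻¹ * e.val * s) (ht : f.val = t⁻¹ * e.val * t),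
      Q.ψ s = Q.ψ t → ∀ a : A e, α.act s hs a = α.act t ht a) :
    GradedAction M fun e => A (Q.lift e) :=
  have key : ∀ (m : M) (t : T) (_ : Q.ψ t = m) {e f : Idem M} (_ : f.val = m⁻¹ * e.val * m),
      (Q.lift f).val = t⁻¹ * (Q.lift e).val * t := by
    intro m t ht e f h
    refine Q.idem_eq (Q.lift f).idem (conj_idem (Q.lift e).idem t) ?_
    rw [map_mul, map_mul, map_inv', ht, Q.ψ_lift, Q.ψ_lift, h]
  { act := fun m {_ _} h => α.act (Q.pick m) (key m _ (Q.ψ_pick m) h)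
    act_mul := by
      intro s t e f g h1 h2 h3 a
      rw [← α.act_mul _ _ _ _ (key (s * t) _ (by rw [map_mul, Q.ψ_pick, Q.ψ_pick]) h3)]
      exact hα _ _ _ _ (by rw [map_mul, Q.ψ_pick, Q.ψ_pick, Q.ψ_pick]) a
    act_self := by
      intro e h a
      exact (hα _ _ _ (key e.val _ (Q.ψ_lift e) h) (by rw [Q.ψ_pick, Q.ψ_lift]) a).trans
        (α.act_self (Q.lift e) _ a) }

/-! ### The relation module -/

/-- The group `K_e` of elements of `T` with the same image in `M` as the idempotent `e`. -/
@[ext] structure Ker (e : Idem T) : Type u where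
  val : T
  ψ_val : Q.ψ val = Q.ψ e.val

namespace Ker

variable {Q} {e : Idem T}

instance : Mul (Ker Q e) :=
  ⟨fun a b => ⟨a.val * b.val, by rw [map_mul, a.ψ_val, b.ψ_val, ← map_mul, e.idem]⟩⟩

instance : One (Ker Q e) := ⟨⟨e.val, rfl⟩⟩

instance : Inv (Ker Q e) :=
  ⟨fun a => ⟨a.val⁻¹, by rw [map_inv', a.ψ_val, ← map_inv', idem_inv e.idem]⟩⟩

instance : Group (Ker Q e) :=
  Group.ofLeftAxioms (fun a b c => Ker.ext (mul_assoc a.val b.val c.val))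
    (fun a => Ker.ext (Q.idem_mul_of_ker a.ψ_val)) (fun a => Ker.ext (Q.inv_mul_of_ker a.ψ_val))

/-- Conjugation `k ↦ t⁻¹kt`. -/
def conj (t : T) {f : Idem T} (h : f.val = t⁻¹ * e.val * t) : Ker Q e →* Ker Q f where
  toFun k := ⟨t⁻¹ * k.val * t, by rw [h, map_mul, map_mul, k.ψ_val, ← map_mul, ← map_mul]⟩
  map_one' := Ker.ext h.symm
  map_mul' a b := Ker.ext (by
    change t⁻¹ * (a.val * b.val) * t = t⁻¹ * a.val * t * (t⁻¹ * b.val * t)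
    calc t⁻¹ * (a.val * b.val) * t = t⁻¹ * t * t⁻¹ * (a.val * b.val) * t := by rw [inv_mul_inv]
      _ = t⁻¹ * (t * t⁻¹ * a.val) * b.val * t := by simp only [mul_assoc]
      _ = _ := by rw [← Q.ker_comm a.ψ_val (mul_inv_idem t)]; simp only [mul_assoc])

theorem conj_conj (s t : T) {f g : Idem T} (h1 : f.val = s⁻¹ * e.val * s)
    (h2 : g.val = t⁻¹ * f.val * t) (h3 : g.val = (s * t)⁻¹ * e.val * (s * t)) (k : Ker Q e) :
    conj (s * t) h3 k = conj t h2 (conj s h1 k) :=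
  Ker.ext (by
    change (s * t)⁻¹ * k.val * (s * t) = t⁻¹ * (s⁻¹ * k.val * s) * t
    rw [mul_inv_rev']; simp only [mul_assoc])

/-- For elements `s`, `t` with the same image in `M`, the element `s⁻¹et` of `K_f`. -/
def diff (s t : T) {f : Idem T} (hs : f.val = s⁻¹ * e.val * s) (hst : Q.ψ s = Q.ψ t) : Ker Q f :=
  ⟨s⁻¹ * e.val * t, by rw [hs, map_mul, ← hst, ← map_mul]⟩

theorem conj_diff (s t : T) {f : Idem T} (hs : f.val = s⁻¹ * e.val * s)
    (ht : f.val = t⁻¹ * e.val * t) (hst : Q.ψ s = Q.ψ t) (k : Ker Q e) :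
    conj s hs k * diff s t hs hst = diff s t hs hst * conj t ht k :=
  Ker.ext (by
    change s⁻¹ * k.val * s * (s⁻¹ * e.val * t) = s⁻¹ * e.val * t * (t⁻¹ * k.val * t)
    calc s⁻¹ * k.val * s * (s⁻¹ * e.val * t) = s⁻¹ * (k.val * (s * s⁻¹)) * e.val * t := by
          simp only [mul_assoc]
      _ = s⁻¹ * s * s⁻¹ * (k.val * e.val) * t := by
          rw [Q.ker_comm k.ψ_val (mul_inv_idem s)]; simp only [mul_assoc]
      _ = s⁻¹ * k.val * t := by rw [inv_mul_inv, Q.mul_idem_of_ker k.ψ_val]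
      _ = s⁻¹ * (e.val * k.val) * (t * t⁻¹ * t) := by
          rw [mul_inv_mul, Q.idem_mul_of_ker k.ψ_val]
      _ = s⁻¹ * e.val * (k.val * (t * t⁻¹)) * t := by simp only [mul_assoc]
      _ = _ := by rw [Q.ker_comm k.ψ_val (mul_inv_idem t)]; simp only [mul_assoc])

end Ker

/-- The abelianised groups `K_e^ab`. -/
abbrev KerAb (e : Idem T) : Type u := Additive (Abelianization (Ker Q e))

/-- The action of `T` on the groups `K_e^ab` by conjugation. -/
def kerAction : GradedAction T Q.KerAb where
  act t {_ _} h := MonoidHom.toAdditive (Abelianization.map (Ker.conj t h))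
  act_mul s t {e f g} h1 h2 h3 a := by
    induction a using Additive.rec with | _ a
    induction a using QuotientGroup.induction_on with | _ k
    exact congrArg (fun k => Additive.ofMul (Abelianization.of k)) (Ker.conj_conj s t h1 h2 h3 k)
  act_self e h a := by
    induction a using Additive.rec with | _ a
    induction a using QuotientGroup.induction_on with | _ k
    refine congrArg (fun k => Additive.ofMul (Abelianization.of k)) (Ker.ext ?_)
    change e.val⁻¹ * k.val * e.val = k.val
    rw [idem_inv e.idem, Q.idem_mul_of_ker k.ψ_val, Q.mul_idem_of_ker k.ψ_val]

theorem of_eq_of_conj {G : Type u} [Group G] {a b u : G} (h : a * u = u * b) :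
    Abelianization.of a = Abelianization.of b := by
  have := congrArg Abelianization.of h
  rw [map_mul, map_mul, mul_comm] at this
  exact mul_left_cancel this

theorem kerAction_congr (s t : T) {e f : Idem T} (hs : f.val = s⁻¹ * e.val * s)
    (ht : f.val = t⁻¹ * e.val * t) (hst : Q.ψ s = Q.ψ t) (a : Q.KerAb e) :
    Q.kerAction.act s hs a = Q.kerAction.act t ht a := by
  induction a using Additive.rec with | _ a
  induction a using QuotientGroup.induction_on with | _ k
  exact congrArg Additive.ofMul (of_eq_of_conj (Ker.conj_diff s t hs ht hst k))

/-- The module `⊔ K_e^ab`, with the action `k ◁ m = t⁻¹kt` for any `t` over `m`. -/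
noncomputable def kerModule : LauschModule.{v, u} M :=
  (Q.descend Q.kerAction Q.kerAction_congr).toModule

end SepQuotient

/-! ### The Squier complex and its fundamental groupoid -/

namespace SepQuotient

variable {ι : Type w} {T : Type u} {M : Type v} [InverseMonoid T] [InverseMonoid M]
  (Q : SepQuotient ι T M)

/-- An edge `(p, l, r, q)` of the Squier complex, with an orientation: it leads from `plq` to `prq`
if `fwd` is true, and is the reverse of that edge otherwise. -/
@[ext] structure Edge (Q : SepQuotient ι T M) : Type (max u w) where
  p : T
  rel : ι
  q : T
  fwd : Bool

namespace Edge

variable {Q}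

/-- The initial vertex. -/
def src (s : Edge Q) : T := s.p * (bif s.fwd then Q.lhs s.rel else Q.rhs s.rel) * s.q

/-- The terminal vertex. -/
def tgt (s : Edge Q) : T := s.p * (bif s.fwd then Q.rhs s.rel else Q.lhs s.rel) * s.q

/-- The reverse edge. -/
def symm (s : Edge Q) : Edge Q := ⟨s.p, s.rel, s.q, !s.fwd⟩

/-- `x ▷ (p, l, r, q) = (xp, l, r, q)`. -/
def wL (x : T) (s : Edge Q) : Edge Q := ⟨x * s.p, s.rel, s.q, s.fwd⟩

/-- `(p, l, r, q) ◁ y = (p, l, r, qy)`. -/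
def wR (y : T) (s : Edge Q) : Edge Q := ⟨s.p, s.rel, s.q * y, s.fwd⟩

theorem src_symm (s : Edge Q) : s.symm.src = s.tgt := by
  rcases s with ⟨p, i, q, _ | _⟩ <;> rfl

theorem tgt_symm (s : Edge Q) : s.symm.tgt = s.src := by
  rcases s with ⟨p, i, q, _ | _⟩ <;> rfl

theorem symm_symm (s : Edge Q) : s.symm.symm = s := by
  rcases s with ⟨p, i, q, _ | _⟩ <;> rfl

theorem src_wL (x : T) (s : Edge Q) : (s.wL x).src = x * s.src := by
  simp only [wL, src, mul_assoc]

theorem tgt_wL (x : T) (s : Edge Q) : (s.wL x).tgt = x * s.tgt := by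
  simp only [wL, tgt, mul_assoc]

theorem src_wR (x : T) (s : Edge Q) : (s.wR x).src = s.src * x := by
  simp only [wR, src, mul_assoc]

theorem tgt_wR (x : T) (s : Edge Q) : (s.wR x).tgt = s.tgt * x := by
  simp only [wR, tgt, mul_assoc]

theorem ψ_src (s : Edge Q) : Q.ψ s.src = Q.ψ s.tgt := by
  have h : ∀ i, Q.ψ (Q.lhs i) = Q.ψ (Q.rhs i) := fun i => by
    have : Con.ker Q.ψ (Q.lhs i) (Q.rhs i) := by
      rw [Q.ker_eq]; exact ConGen.Rel.of _ _ ⟨i, rfl, rfl⟩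
    exact this
  rcases s with ⟨p, i, q, _ | _⟩ <;> simp [src, tgt, h]

end Edge

/-- `L` is an edge path from `a` to `b`. -/
def IsPath : T → List (Edge Q) → T → Prop
  | a, [], b => a = b
  | a, s :: L, b => s.src = a ∧ IsPath s.tgt L b

theorem isPath_append {Q : SepQuotient ι T M} {L L' : List (Edge Q)} {a b c : T} (h : Q.IsPath a L b)
    (h' : Q.IsPath b L' c) : Q.IsPath a (L ++ L') c := by
  induction L generalizing a with
  | nil => cases h; exact h'
  | cons s L ih => exact ⟨h.1, ih h.2⟩

/-- The elementary homotopies: deletion of an edge followed by its reverse, and replacement of one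
half of the boundary of a `2`-cell by the other half. -/
inductive Elementary : List (Edge Q) → List (Edge Q) → Prop
  | cancel (U V : List (Edge Q)) (s : Edge Q) : Elementary (U ++ s :: s.symm :: V) (U ++ V)
  | square (U V : List (Edge Q)) (p q p' q' : T) (i j : ι) :
      Elementary
        (U ++ ⟨p, i, q * p' * Q.lhs j * q', true⟩ :: ⟨p * Q.rhs i * q * p', j, q', true⟩ :: V)
        (U ++ ⟨p * Q.lhs i * q * p', j, q', true⟩ :: ⟨p, i, q * p' * Q.rhs j * q', true⟩ :: V)

/-- Edge paths in the Squier complex. -/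
@[ext] structure EdgePath : Type (max u w) where
  src : T
  tgt : T
  steps : List (Edge Q)
  isPath : Q.IsPath src steps tgt

namespace EdgePath

variable {Q}

/-- Elementary homotopy of edge paths with the same end points. -/
def Step (a b : EdgePath Q) : Prop :=
  a.src = b.src ∧ a.tgt = b.tgt ∧ Q.Elementary a.steps b.steps

/-- The constant path. -/
def const (x : T) : EdgePath Q := ⟨x, x, [], rfl⟩

/-- Concatenation of paths. -/
def comp (a b : EdgePath Q) (h : a.tgt = b.src) : EdgePath Q :=
  ⟨a.src, b.tgt, a.steps ++ b.steps, isPath_append a.isPath (h ▸ b.isPath)⟩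

/-- The path consisting of one edge. -/
def single (s : Edge Q) : EdgePath Q := ⟨s.src, s.tgt, [s], rfl, rfl⟩

theorem isPath_rev {L : List (Edge Q)} {a b : T} (h : Q.IsPath a L b) :
    Q.IsPath b (L.reverse.map Edge.symm) a := by
  induction L generalizing a with
  | nil => exact h.symm
  | cons s L ih =>
    rw [List.reverse_cons, List.map_append]
    exact isPath_append (ih h.2) ⟨s.src_symm, s.tgt_symm.trans h.1⟩

/-- The reverse path. -/
def rev (a : EdgePath Q) : EdgePath Q :=
  ⟨a.tgt, a.src, a.steps.reverse.map Edge.symm, isPath_rev a.isPath⟩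

/-- The left action of `T` on paths. -/
def wL (x : T) (a : EdgePath Q) : EdgePath Q where
  src := x * a.src
  tgt := x * a.tgt
  steps := a.steps.map (Edge.wL x)
  isPath := by
    rcases a with ⟨a, b, L, h⟩
    induction L generalizing a with
    | nil => exact congrArg (x * ·) h
    | cons s L ih =>
      refine ⟨(s.src_wL x).trans (congrArg (x * ·) h.1), ?_⟩
      rw [Edge.tgt_wL]
      exact ih _ h.2

/-- The right action of `T` on paths. -/
def wR (y : T) (a : EdgePath Q) : EdgePath Q where
  src := a.src * y
  tgt := a.tgt * y
  steps := a.steps.map (Edge.wR y)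
  isPath := by
    rcases a with ⟨a, b, L, h⟩
    induction L generalizing a with
    | nil => exact congrArg (· * y) h
    | cons s L ih =>
      refine ⟨(s.src_wR y).trans (congrArg (· * y) h.1), ?_⟩
      rw [Edge.tgt_wR]
      exact ih _ h.2

/-- `a ∗ b = (a ◁ d(b)) ∘ (r(a) ▷ b)`. -/
def ast (a b : EdgePath Q) : EdgePath Q := comp (wR b.src a) (wL a.tgt b) rfl

/-- `a ⊛ b = (d(a) ▷ b) ∘ (a ◁ r(b))`. -/
def ast' (a b : EdgePath Q) : EdgePath Q := comp (wL a.src b) (wR b.tgt a) rfl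

theorem wL_wL (x y : T) (a : EdgePath Q) : wL x (wL y a) = wL (x * y) a := by
  ext1
  · exact (mul_assoc _ _ _).symm
  · exact (mul_assoc _ _ _).symm
  · simp only [wL, List.map_map]
    congr 1; funext s; simp only [Function.comp, Edge.wL, mul_assoc]

theorem wR_wR (x y : T) (a : EdgePath Q) : wR x (wR y a) = wR (y * x) a := by
  ext1
  · exact mul_assoc _ _ _
  · exact mul_assoc _ _ _
  · simp only [wR, List.map_map]
    congr 1; funext s; simp only [Function.comp, Edge.wR, mul_assoc]

theorem wL_wR (x y : T) (a : EdgePath Q) : wL x (wR y a) = wR y (wL x a) := by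
  ext1
  · exact (mul_assoc _ _ _).symm
  · exact (mul_assoc _ _ _).symm
  · simp only [wR, wL, List.map_map]
    congr 1

theorem comp_eq {a a' b b' : EdgePath Q} (ha : a = a') (hb : b = b') (h : a.tgt = b.src)
    (h' : a'.tgt = b'.src) : comp a b h = comp a' b' h' := by
  subst ha hb; rfl

theorem comp_assoc (a b c : EdgePath Q) (h1 : a.tgt = b.src) (h2 : b.tgt = c.src) :
    comp (comp a b h1) c h2 = comp a (comp b c h2) h1 := by
  ext1
  · rfl
  · rfl
  · exact List.append_assoc _ _ _

theorem wL_comp (x : T) (a b : EdgePath Q) (h : a.tgt = b.src) :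
    wL x (comp a b h) = comp (wL x a) (wL x b) (congrArg (x * ·) h) := by
  ext1
  · rfl
  · rfl
  · exact List.map_append

theorem wR_comp (x : T) (a b : EdgePath Q) (h : a.tgt = b.src) :
    wR x (comp a b h) = comp (wR x a) (wR x b) (congrArg (· * x) h) := by
  ext1
  · rfl
  · rfl
  · exact List.map_append

theorem rev_rev (a : EdgePath Q) : a.rev.rev = a := by
  ext1
  · rfl
  · rfl
  · simp only [rev, ← List.map_reverse, List.reverse_reverse, List.map_map]
    conv_rhs => rw [← List.map_id a.steps]
    congr 1; funext s; exact s.symm_symm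

theorem rev_comp (a b : EdgePath Q) (h : a.tgt = b.src) :
    (comp a b h).rev = comp b.rev a.rev h.symm := by
  ext1
  · rfl
  · rfl
  · simp only [rev, comp, List.reverse_append, List.map_append]

theorem rev_wL (x : T) (a : EdgePath Q) : (wL x a).rev = wL x a.rev := by
  ext1
  · rfl
  · rfl
  · simp only [rev, wL, ← List.map_reverse, List.map_map]
    congr 1

theorem rev_wR (x : T) (a : EdgePath Q) : (wR x a).rev = wR x a.rev := by
  ext1
  · rfl
  · rfl
  · simp only [rev, wR, ← List.map_reverse, List.map_map]
    congr 1

theorem const_comp (a : EdgePath Q) (x : T) (h : x = a.src) : comp (const x) a h = a := by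
  subst h; rfl

theorem comp_const (a : EdgePath Q) (x : T) (h : a.tgt = x) : comp a (const x) h = a := by
  subst h
  ext1
  · rfl
  · rfl
  · exact List.append_nil _

theorem ast_assoc (a b c : EdgePath Q) : ast (ast a b) c = ast a (ast b c) := by
  refine (comp_eq (wR_comp c.src (wR b.src a) (wL a.tgt b) rfl) rfl rfl rfl).trans
    ((comp_assoc _ _ _ _ _).trans ?_)
  refine comp_eq (wR_wR _ _ _) ?_ _ _
  exact (comp_eq (wL_wR _ _ _).symm (wL_wL a.tgt b.tgt c).symm _ rfl).trans
    (wL_comp a.tgt (wR c.src b) (wL b.tgt c) rfl).symm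

theorem induct {P : EdgePath Q → Prop} (h0 : ∀ x, P (const x)) (h1 : ∀ s, P (single s))
    (h2 : ∀ a b h, P a → P b → P (comp a b h)) (a : EdgePath Q) : P a := by
  rcases a with ⟨x, y, L, h⟩
  induction L generalizing x with
  | nil => cases h; exact h0 _
  | cons s L ih =>
    obtain ⟨rfl, h'⟩ := h
    exact h2 (single s) ⟨_, _, L, h'⟩ rfl (h1 s) (ih _ h')

/-- Homotopy of edge paths. -/
def Htpy (a b : EdgePath Q) : Prop := Relation.EqvGen Step a b

theorem Htpy.refl (a : EdgePath Q) : Htpy a a := Relation.EqvGen.refl a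

theorem Htpy.symm {a b : EdgePath Q} (h : Htpy a b) : Htpy b a := Relation.EqvGen.symm _ _ h

theorem Htpy.trans {a b c : EdgePath Q} (h : Htpy a b) (h' : Htpy b c) : Htpy a c :=
  Relation.EqvGen.trans _ _ _ h h'

theorem Htpy.of_eq {a b : EdgePath Q} (h : a = b) : Htpy a b := h ▸ Htpy.refl a

theorem Htpy.src_eq {a b : EdgePath Q} (h : Htpy a b) : a.src = b.src := by
  induction h with
  | rel _ _ h => exact h.1
  | refl => rfl
  | symm _ _ _ ih => exact ih.symm
  | trans _ _ _ _ _ ih1 ih2 => exact ih1.trans ih2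

theorem Htpy.tgt_eq {a b : EdgePath Q} (h : Htpy a b) : a.tgt = b.tgt := by
  induction h with
  | rel _ _ h => exact h.2.1
  | refl => rfl
  | symm _ _ _ ih => exact ih.symm
  | trans _ _ _ _ _ ih1 ih2 => exact ih1.trans ih2

theorem elem_append_right {L L' : List (Edge Q)} (h : Q.Elementary L L') (N : List (Edge Q)) :
    Q.Elementary (L ++ N) (L' ++ N) := by
  cases h with
  | cancel U V s =>
    simpa only [List.append_assoc, List.cons_append] using Elementary.cancel U (V ++ N) s
  | square U V p q p' q' i j =>
    simpa only [List.append_assoc, List.cons_append] using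
      Elementary.square U (V ++ N) p q p' q' i j

theorem elem_append_left {L L' : List (Edge Q)} (h : Q.Elementary L L') (N : List (Edge Q)) :
    Q.Elementary (N ++ L) (N ++ L') := by
  cases h with
  | cancel U V s => simpa only [List.append_assoc] using Elementary.cancel (N ++ U) V s
  | square U V p q p' q' i j =>
    simpa only [List.append_assoc] using Elementary.square (N ++ U) V p q p' q' i j

theorem elem_wL {L L' : List (Edge Q)} (h : Q.Elementary L L') (x : T) :
    Q.Elementary (L.map (Edge.wL x)) (L'.map (Edge.wL x)) := by
  cases h with
  | cancel U V s =>
    rw [List.map_append, List.map_append]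
    exact Elementary.cancel _ _ (s.wL x)
  | square U V p q p' q' i j =>
    rw [List.map_append, List.map_append]
    have := Elementary.square (Q := Q) (U.map (Edge.wL x)) (V.map (Edge.wL x)) (x * p) q p' q' i j
    simpa only [List.map_cons, Edge.wL, mul_assoc] using this

theorem elem_wR {L L' : List (Edge Q)} (h : Q.Elementary L L') (x : T) :
    Q.Elementary (L.map (Edge.wR x)) (L'.map (Edge.wR x)) := by
  cases h with
  | cancel U V s =>
    rw [List.map_append, List.map_append]
    exact Elementary.cancel _ _ (s.wR x)
  | square U V p q p' q' i j =>
    rw [List.map_append, List.map_append]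
    have := Elementary.square (Q := Q) (U.map (Edge.wR x)) (V.map (Edge.wR x)) p q p' (q' * x) i j
    simpa only [List.map_cons, Edge.wR, mul_assoc] using this

theorem Step.wL {a b : EdgePath Q} (h : Step a b) (x : T) : Step (wL x a) (wL x b) :=
  ⟨congrArg (x * ·) h.1, congrArg (x * ·) h.2.1, elem_wL h.2.2 x⟩

theorem Step.wR {a b : EdgePath Q} (h : Step a b) (x : T) : Step (wR x a) (wR x b) :=
  ⟨congrArg (· * x) h.1, congrArg (· * x) h.2.1, elem_wR h.2.2 x⟩

theorem Step.ast_left {a a' : EdgePath Q} (h : Step a a') (b : EdgePath Q) :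
    Step (ast a b) (ast a' b) := by
  refine ⟨(h.wR b.src).1, congrArg (· * b.tgt) h.2.1, ?_⟩
  simp only [ast, comp, h.2.1]
  exact elem_append_right (elem_wR h.2.2 _) _

theorem Step.ast_right {b b' : EdgePath Q} (a : EdgePath Q) (h : Step b b') :
    Step (ast a b) (ast a b') := by
  refine ⟨congrArg (a.src * ·) h.1, (h.wL a.tgt).2.1, ?_⟩
  simp only [ast, comp, h.1]
  exact elem_append_left (elem_wL h.2.2 _) _

theorem Htpy.wL {a b : EdgePath Q} (h : Htpy a b) (x : T) : Htpy (wL x a) (wL x b) := by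
  induction h with
  | rel _ _ h => exact .rel _ _ (h.wL x)
  | refl => exact .refl _
  | symm _ _ _ ih => exact Htpy.symm ih
  | trans _ _ _ _ _ ih1 ih2 => exact Htpy.trans ih1 ih2

theorem Htpy.comp_left {a a' : EdgePath Q} (h : Htpy a a') (b : EdgePath Q) (k : a.tgt = b.src)
    (k' : a'.tgt = b.src) : Htpy (comp a b k) (comp a' b k') := by
  induction h with
  | rel _ _ h => exact .rel _ _ ⟨h.1, rfl, elem_append_right h.2.2 _⟩
  | refl => exact .refl _
  | symm _ _ _ ih => exact Htpy.symm (ih k' k)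
  | trans _ _ _ h1 _ ih1 ih2 => exact Htpy.trans (ih1 k ((Htpy.tgt_eq h1).symm.trans k)) (ih2 _ k')

theorem Htpy.comp_right (a : EdgePath Q) {b b' : EdgePath Q} (h : Htpy b b') (k : a.tgt = b.src)
    (k' : a.tgt = b'.src) : Htpy (comp a b k) (comp a b' k') := by
  induction h with
  | rel _ _ h => exact .rel _ _ ⟨rfl, h.2.1, elem_append_left h.2.2 _⟩
  | refl => exact .refl _
  | symm _ _ _ ih => exact Htpy.symm (ih k' k)
  | trans _ _ _ h1 _ ih1 ih2 => exact Htpy.trans (ih1 k (k.trans (Htpy.src_eq h1))) (ih2 _ k')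

theorem comp_rev_self (a : EdgePath Q) : Htpy (comp a a.rev rfl) (const a.src) := by
  induction a using induct with
  | h0 x => exact .refl _
  | h1 s =>
    exact .rel _ _ ⟨rfl, rfl, Elementary.cancel [] [] s⟩
  | h2 a b h iha ihb =>
    have e1 : comp (comp a b h) (comp a b h).rev rfl =
        comp a (comp (comp b b.rev rfl) a.rev h.symm) h := by
      refine EdgePath.ext rfl rfl ?_
      simp only [comp, rev, List.reverse_append, List.map_append, List.append_assoc]
    rw [e1]
    refine (Htpy.comp_right a ((ihb.comp_left a.rev h.symm h.symm).trans
      (.of_eq (const_comp _ _ h.symm))) h rfl).trans iha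

theorem rev_comp_self (a : EdgePath Q) : Htpy (comp a.rev a rfl) (const a.tgt) := by
  exact (Htpy.of_eq (comp_eq rfl (rev_rev a).symm rfl rfl)).trans (comp_rev_self a.rev)

theorem Htpy.rev {a b : EdgePath Q} (h : Htpy a b) : Htpy a.rev b.rev := by
  have hs := h.src_eq
  have ht := h.tgt_eq
  have s1 : Htpy a.rev (comp a.rev (comp b b.rev rfl) hs) := by
    refine (Htpy.of_eq (comp_const a.rev _ hs).symm).trans ?_
    exact Htpy.comp_right _ (comp_rev_self b).symm _ _
  have s2 : Htpy (comp a.rev (comp b b.rev rfl) hs) (comp a.rev (comp a b.rev ht) rfl) :=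
    Htpy.comp_right _ (h.symm.comp_left _ _ _) _ _
  have s3 : Htpy (comp a.rev (comp a b.rev ht) rfl) b.rev := by
    exact (Htpy.of_eq (comp_assoc a.rev a b.rev rfl ht).symm).trans
      (((rev_comp_self a).comp_left b.rev ht ht).trans (.of_eq (const_comp _ _ ht)))
  exact (s1.trans s2).trans s3

theorem Htpy.flip {A B A' B' : EdgePath Q} (h1 : A.tgt = B'.src) (h2 : B.tgt = A'.src)
    (h : Htpy (comp A B' h1) (comp B A' h2)) :
    Htpy (comp A.rev B h.src_eq) (comp B' A'.rev h.tgt_eq) := by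
  have hs : A.src = B.src := h.src_eq
  have ht : B'.tgt = A'.tgt := h.tgt_eq
  have s1 : Htpy (comp A.rev B hs) (comp A.rev (comp B (comp A' A'.rev rfl) h2) hs) := by
    refine Htpy.comp_right _ ?_ _ _
    exact (Htpy.of_eq (comp_const B _ h2).symm).trans
      (Htpy.comp_right _ (comp_rev_self A').symm _ _)
  have s2 : Htpy (comp A.rev (comp B (comp A' A'.rev rfl) h2) hs)
      (comp A.rev (comp A (comp B' A'.rev ht) h1) rfl) := by
    refine Htpy.comp_right _ ?_ _ _
    exact (Htpy.of_eq (comp_assoc B A' A'.rev h2 rfl).symm).trans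
      ((h.symm.comp_left A'.rev rfl ht).trans (.of_eq (comp_assoc A B' A'.rev h1 ht)))
  refine (s1.trans s2).trans ?_
  exact (Htpy.of_eq (comp_assoc A.rev A (comp B' A'.rev ht) rfl h1).symm).trans
    (((rev_comp_self A).comp_left (comp B' A'.rev ht) h1 h1).trans
      (.of_eq (const_comp (comp B' A'.rev ht) _ h1)))

/-- The operations `∗` and `⊛` coincide up to homotopy. -/
theorem interchange (a b : EdgePath Q) : Htpy (ast a b) (ast' a b) := by
  have base : ∀ p i q p' j q', Htpy (ast (single (Q := Q) ⟨p, i, q, true⟩) (single ⟨p', j, q', true⟩))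
      (ast' (single ⟨p, i, q, true⟩) (single ⟨p', j, q', true⟩)) := by
    intro p i q p' j q'
    refine .rel _ _ ⟨rfl, rfl, ?_⟩
    have := Elementary.square (Q := Q) [] [] p q p' q' i j
    simpa [ast, ast', comp, single, wL, wR, Edge.wL, Edge.wR, Edge.src, Edge.tgt, mul_assoc]
      using this
  have revL : ∀ a b : EdgePath Q, Htpy (ast a b) (ast' a b) →
      Htpy (ast a.rev b) (ast' a.rev b) := by
    intro a b h
    have h' := Htpy.flip _ _ h
    refine (Htpy.of_eq ?_).trans (h'.trans (.of_eq ?_))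
    · exact comp_eq (rev_wR b.src a).symm rfl _ _
    · exact comp_eq rfl (rev_wR b.tgt a) _ _
  have revR : ∀ a b : EdgePath Q, Htpy (ast a b) (ast' a b) →
      Htpy (ast a b.rev) (ast' a b.rev) := by
    intro a b h
    have h' := (Htpy.flip _ _ h.symm).symm
    refine (Htpy.of_eq ?_).trans (h'.trans (.of_eq ?_))
    · exact comp_eq rfl (rev_wL a.tgt b).symm _ _
    · exact comp_eq (rev_wL a.src b) rfl _ _
  have sing : ∀ s : Edge Q, ∃ t : Edge Q, t.fwd = true ∧
      (single s = single t ∨ single s = (single t).rev) := by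
    rintro ⟨p, i, q, _ | _⟩
    · exact ⟨⟨p, i, q, true⟩, rfl, Or.inr rfl⟩
    · exact ⟨⟨p, i, q, true⟩, rfl, Or.inl rfl⟩
  induction a using induct with
  | h0 x =>
    exact .of_eq ((const_comp (wL x b) _ rfl).trans (comp_const (wL x b) _ rfl).symm)
  | h2 a₁ a₂ h ih1 ih2 =>
    have s1 : ast (comp a₁ a₂ h) b =
        comp (wR b.src a₁) (ast a₂ b) (congrArg (· * b.src) h) := by
      refine EdgePath.ext rfl rfl ?_
      simp only [ast, comp, wR, List.map_append, List.append_assoc]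
    have s2 : comp (wR b.src a₁) (ast' a₂ b) (congrArg (· * b.src) h) =
        comp (ast a₁ b) (wR b.tgt a₂) (congrArg (· * b.tgt) h) := by
      refine EdgePath.ext rfl rfl ?_
      simp only [ast, ast', comp, h, List.append_assoc]
    have s3 : comp (ast' a₁ b) (wR b.tgt a₂) (congrArg (· * b.tgt) h) = ast' (comp a₁ a₂ h) b := by
      refine EdgePath.ext rfl rfl ?_
      simp only [ast', comp, wR, List.map_append, List.append_assoc]
    rw [s1, ← s3]
    exact ((Htpy.comp_right _ ih2 _ _).trans (.of_eq s2)).trans (ih1.comp_left _ _ _)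
  | h1 s =>
    induction b using induct with
    | h0 x =>
      exact .of_eq ((comp_const (wR x (single s)) _ rfl).trans
        (const_comp (wR x (single s)) _ rfl).symm)
    | h1 t =>
      obtain ⟨s', hs, h1⟩ := sing s
      obtain ⟨t', ht, h2⟩ := sing t
      rcases s' with ⟨p, i, q, fs⟩
      rcases t' with ⟨p', j, q', ft⟩
      dsimp only at hs ht
      subst hs ht
      have h0 := base p i q p' j q'
      rcases h1 with h1 | h1 <;> rcases h2 with h2 | h2 <;> rw [h1, h2]
      · exact h0
      · exact revR _ _ h0
      · exact revL _ _ h0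
      · exact revL _ _ (revR _ _ h0)
    | h2 b₁ b₂ h ih1 ih2 =>
      have s1 : ast (single s) (comp b₁ b₂ h) =
          comp (ast (single s) b₁) (wL s.tgt b₂) (congrArg (s.tgt * ·) h) := by
        refine EdgePath.ext rfl rfl ?_
        simp only [ast, comp, single, wL, List.map_append, List.append_assoc]
      have s2 : comp (ast' (single s) b₁) (wL s.tgt b₂) (congrArg (s.tgt * ·) h) =
          comp (wL s.src b₁) (ast (single s) b₂) (congrArg (s.src * ·) h) := by
        refine EdgePath.ext rfl rfl ?_
        simp only [ast, ast', comp, single, h, List.append_assoc]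
      have s3 : comp (wL s.src b₁) (ast' (single s) b₂) (congrArg (s.src * ·) h) =
          ast' (single s) (comp b₁ b₂ h) := by
        refine EdgePath.ext rfl rfl ?_
        simp only [ast', comp, single, wL, List.map_append, List.append_assoc]
      rw [s1, ← s3]
      exact ((ih1.comp_left _ _ _).trans (.of_eq s2)).trans (Htpy.comp_right _ ih2 _ _)

theorem ψ_src (a : EdgePath Q) : Q.ψ a.src = Q.ψ a.tgt := by
  induction a using induct with
  | h0 x => rfl
  | h1 s => exact s.ψ_src
  | h2 a b h iha ihb => exact iha.trans ((congrArg Q.ψ h).trans ihb)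

/-- Two elements of `T` with the same image in `M` are joined by a path. -/
theorem exists_path {x y : T} (h : Q.ψ x = Q.ψ y) : ∃ a : EdgePath Q, a.src = x ∧ a.tgt = y := by
  let c : Con T :=
    { r := fun x y => ∃ a : EdgePath Q, a.src = x ∧ a.tgt = y
      iseqv :=
        { refl := fun x => ⟨const x, rfl, rfl⟩
          symm := fun ⟨a, h1, h2⟩ => ⟨a.rev, h2, h1⟩
          trans := fun ⟨a, h1, h2⟩ ⟨b, k1, k2⟩ => ⟨comp a b (h2.trans k1.symm), h1, k2⟩ }
      mul' := fun ⟨a, h1, h2⟩ ⟨b, k1, k2⟩ => ⟨ast a b,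
        by rw [← h1, ← k1]; rfl, by rw [← h2, ← k2]; rfl⟩ }
  have hle : Con.ker Q.ψ ≤ c := by
    rw [Q.ker_eq, Con.conGen_le]
    rintro _ _ ⟨i, rfl, rfl⟩
    exact ⟨single ⟨1, i, 1, true⟩, by simp [single, Edge.src], by simp [single, Edge.tgt]⟩
  exact hle (show Con.ker Q.ψ x y from h)

end EdgePath

/-- The fundamental groupoid of the Squier complex: homotopy classes of edge paths. -/
def Arrow : Type (max u w) := Quot (EdgePath.Step (Q := Q))

namespace Arrow

variable {Q}

/-- The homotopy class of a path. -/
def mk (a : EdgePath Q) : Arrow Q := Quot.mk _ a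

theorem mk_eq {a b : EdgePath Q} (h : EdgePath.Htpy a b) : mk a = mk b := Quot.eqvGen_sound h

theorem mk_surjective (α : Arrow Q) : ∃ a, mk a = α := Quot.exists_rep α

/-- The domain map `d`. -/
def src : Arrow Q → T := Quot.lift EdgePath.src fun _ _ h => h.1

/-- The range map `r`. -/
def tgt : Arrow Q → T := Quot.lift EdgePath.tgt fun _ _ h => h.2.1

/-- The inverse in the fundamental groupoid. -/
def rev : Arrow Q → Arrow Q :=
  Quot.lift (fun a => mk a.rev) fun _ _ h => mk_eq (EdgePath.Htpy.rev (.rel _ _ h))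

/-- The left action `x ▷ α`. -/
def wL (x : T) : Arrow Q → Arrow Q := Quot.map (EdgePath.wL x) fun _ _ h => h.wL x

/-- The right action `α ◁ y`. -/
def wR (y : T) : Arrow Q → Arrow Q := Quot.map (EdgePath.wR y) fun _ _ h => h.wR y

/-- The operation `α ∗ β = (α ◁ d(β)) ∘ (r(α) ▷ β)`. -/
def ast : Arrow Q → Arrow Q → Arrow Q :=
  Quot.map₂ EdgePath.ast (fun a _ _ h => EdgePath.Step.ast_right a h)
    (fun _ _ b h => EdgePath.Step.ast_left h b)

end Arrow

/-- The set `star_e^⋈ = {e ▷ α ◁ e : d(α) = e}`. -/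
@[ext] structure Star (e : Idem T) : Type (max u w) where
  val : Arrow Q
  exists_eq : ∃ α : Arrow Q, α.src = e.val ∧ val = (α.wR e.val).wL e.val

namespace Star

variable {Q} {e : Idem T}

/-- Paths `a` with domain `e` and `e ▷ a = a = a ◁ e`. -/
structure Good (e : Idem T) (a : EdgePath Q) : Prop where
  src_eq : a.src = e.val
  wL_eq : a.wL e.val = a
  wR_eq : a.wR e.val = a

theorem Good.ψ_tgt {a : EdgePath Q} (h : Good e a) : Q.ψ a.tgt = Q.ψ e.val := by
  rw [← a.ψ_src, h.src_eq]

theorem exists_good (α : Star Q e) : ∃ a : EdgePath Q, Good e a ∧ Arrow.mk a = α.val := by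
  rcases α with ⟨val, α, hα, rfl⟩
  obtain ⟨a, rfl⟩ := Arrow.mk_surjective α
  refine ⟨(a.wR e.val).wL e.val, ⟨?_, ?_, ?_⟩, rfl⟩
  · change e.val * (a.src * e.val) = e.val
    rw [show a.src = e.val from hα, e.idem, e.idem]
  · rw [EdgePath.wL_wL, e.idem]
  · rw [← EdgePath.wL_wR, EdgePath.wR_wR, e.idem]

/-- The element of `star_e^⋈` represented by a path. -/
def ofGood (a : EdgePath Q) (h : Good e a) : Star Q e :=
  ⟨Arrow.mk a, Arrow.mk a, h.src_eq, by
    change Arrow.mk a = Arrow.mk ((a.wR e.val).wL e.val)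
    rw [h.wR_eq, h.wL_eq]⟩

theorem ofGood_surjective (α : Star Q e) : ∃ a, ∃ h : Good e a, α = ofGood a h := by
  obtain ⟨a, h, h'⟩ := α.exists_good
  exact ⟨a, h, Star.ext h'.symm⟩

theorem Good.ast {a b : EdgePath Q} (ha : Good e a) (hb : Good e b) : Good e (a.ast b) := by
  refine ⟨?_, ?_, ?_⟩
  · change a.src * b.src = _
    rw [ha.src_eq, hb.src_eq, e.idem]
  · refine (EdgePath.wL_comp _ _ _ _).trans (EdgePath.comp_eq ?_ ?_ _ _)
    · rw [EdgePath.wL_wR, ha.wL_eq]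
    · rw [EdgePath.wL_wL, Q.idem_mul_of_ker ha.ψ_tgt]
  · refine (EdgePath.wR_comp _ _ _ _).trans (EdgePath.comp_eq ?_ ?_ _ _)
    · rw [EdgePath.wR_wR, hb.src_eq, e.idem]
    · rw [← EdgePath.wL_wR, hb.wR_eq]

theorem good_const : Good e (EdgePath.const (Q := Q) e.val) := by
  refine ⟨rfl, ?_, ?_⟩
  · ext1
    · exact e.idem
    · exact e.idem
    · rfl
  · ext1
    · exact e.idem
    · exact e.idem
    · rfl

theorem ker_inv {x : T} (h : Q.ψ x = Q.ψ e.val) : Q.ψ x⁻¹ = Q.ψ e.val := by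
  rw [map_inv', h, ← map_inv', idem_inv e.idem]

theorem Good.inv {a : EdgePath Q} (ha : Good e a) :
    Good e ((a.rev.wR a.src⁻¹).wL a.tgt⁻¹) := by
  refine ⟨?_, ?_, ?_⟩
  · change a.tgt⁻¹ * (a.tgt * a.src⁻¹) = _
    rw [← mul_assoc, Q.inv_mul_of_ker ha.ψ_tgt, ha.src_eq, idem_inv e.idem, e.idem]
  · rw [EdgePath.wL_wL, Q.idem_mul_of_ker (ker_inv ha.ψ_tgt)]
  · rw [← EdgePath.wL_wR, EdgePath.wR_wR, ha.src_eq, idem_inv e.idem, e.idem]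

/-- The operation `∗` on `star_e^⋈`. -/
instance : Mul (Star Q e) :=
  ⟨fun α β => ⟨α.val.ast β.val, by
    obtain ⟨a, ha, rfl⟩ := α.ofGood_surjective
    obtain ⟨b, hb, rfl⟩ := β.ofGood_surjective
    exact (ofGood _ (ha.ast hb)).exists_eq⟩⟩

/-- The identity arrow at `e`. -/
instance : One (Star Q e) := ⟨ofGood (EdgePath.const e.val) good_const⟩

/-- The inverse `α^* = r(α)⁻¹ ▷ α° ◁ d(α)⁻¹`, where `α°` is the inverse in the groupoid. -/
instance : Inv (Star Q e) :=
  ⟨fun α => ⟨(α.val.rev.wR α.val.src⁻¹).wL α.val.tgt⁻¹, by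
    obtain ⟨a, ha, rfl⟩ := α.ofGood_surjective
    exact (ofGood _ ha.inv).exists_eq⟩⟩

theorem ofGood_mul {a b : EdgePath Q} (ha : Good e a) (hb : Good e b) :
    ofGood a ha * ofGood b hb = ofGood (a.ast b) (ha.ast hb) := rfl

theorem ofGood_eq {a b : EdgePath Q} (ha : Good e a) (hb : Good e b) (h : EdgePath.Htpy a b) :
    ofGood a ha = ofGood b hb := Star.ext (Arrow.mk_eq h)

instance : Group (Star Q e) :=
  Group.ofLeftAxioms
    (fun α β γ => by
      obtain ⟨a, ha, rfl⟩ := α.ofGood_surjective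
      obtain ⟨b, hb, rfl⟩ := β.ofGood_surjective
      obtain ⟨c, hc, rfl⟩ := γ.ofGood_surjective
      exact ofGood_eq ((ha.ast hb).ast hc) (ha.ast (hb.ast hc)) (.of_eq (a.ast_assoc b c)))
    (fun α => by
      obtain ⟨a, ha, rfl⟩ := α.ofGood_surjective
      refine ofGood_eq (good_const.ast ha) ha (.of_eq ?_)
      exact (EdgePath.const_comp (a.wL e.val) _ rfl).trans ha.wL_eq)
    (fun α => by
      obtain ⟨a, ha, rfl⟩ := α.ofGood_surjective
      refine ofGood_eq (ha.inv.ast ha) good_const ?_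
      have h1 : ((a.rev.wR a.src⁻¹).wL a.tgt⁻¹).ast a =
          (EdgePath.comp a.rev a rfl).wL a.tgt⁻¹ := by
        refine Eq.trans (EdgePath.comp_eq ?_ ?_ rfl rfl)
          (EdgePath.wL_comp a.tgt⁻¹ a.rev a rfl).symm
        · rw [← EdgePath.wL_wR, EdgePath.wR_wR, ha.src_eq, idem_inv e.idem, e.idem,
            ← EdgePath.rev_wR, ha.wR_eq]
        · change a.wL (a.tgt⁻¹ * (a.src * a.src⁻¹)) = _
          rw [ha.src_eq, idem_inv e.idem, e.idem, Q.mul_idem_of_ker (ker_inv ha.ψ_tgt)]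
      rw [h1]
      refine (a.rev_comp_self.wL _).trans (.of_eq ?_)
      have h2 := Q.inv_mul_of_ker ha.ψ_tgt
      ext1
      · exact h2
      · exact h2
      · rfl)

theorem Good.act {a : EdgePath Q} (ha : Good e a) (t : T) {f : Idem T}
    (h : f.val = t⁻¹ * e.val * t) : Good f ((a.wR t).wL t⁻¹) := by
  refine ⟨?_, ?_, ?_⟩
  · change t⁻¹ * (a.src * t) = _
    rw [h, ha.src_eq, mul_assoc]
  · conv_lhs => rw [← ha.wL_eq]
    conv_rhs => rw [← ha.wL_eq]
    rw [← EdgePath.wL_wR, EdgePath.wL_wL t⁻¹, EdgePath.wL_wL]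
    congr 1
    rw [h]
    calc t⁻¹ * e.val * t * (t⁻¹ * e.val) = t⁻¹ * (e.val * (t * t⁻¹)) * e.val := by
          simp only [mul_assoc]
      _ = t⁻¹ * t * t⁻¹ * (e.val * e.val) := by
          rw [idem_comm e.idem (mul_inv_idem t)]; simp only [mul_assoc]
      _ = _ := by rw [inv_mul_inv, e.idem]
  · conv_lhs => rw [← ha.wR_eq]
    conv_rhs => rw [← ha.wR_eq]
    rw [← EdgePath.wL_wR, EdgePath.wR_wR, EdgePath.wR_wR, EdgePath.wR_wR]
    congr 2
    rw [h]
    calc e.val * (t * (t⁻¹ * e.val * t)) = e.val * (t * t⁻¹ * e.val) * t := by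
          simp only [mul_assoc]
      _ = e.val * e.val * (t * t⁻¹ * t) := by
          rw [← idem_comm e.idem (mul_inv_idem t)]; simp only [mul_assoc]
      _ = _ := by rw [mul_inv_mul, e.idem]

/-- The map `α ↦ t⁻¹ ▷ α ◁ t`. -/
def act (t : T) {f : Idem T} (h : f.val = t⁻¹ * e.val * t) : Star Q e →* Star Q f where
  toFun α := ⟨(α.val.wR t).wL t⁻¹, by
    obtain ⟨a, ha, rfl⟩ := α.ofGood_surjective
    exact (ofGood _ (ha.act t h)).exists_eq⟩
  map_one' := by
    refine ofGood_eq (good_const.act t h) good_const (.of_eq ?_)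
    have h' : t⁻¹ * (e.val * t) = f.val := by rw [h, mul_assoc]
    ext1
    · exact h'
    · exact h'
    · rfl
  map_mul' α β := by
    obtain ⟨a, ha, rfl⟩ := α.ofGood_surjective
    obtain ⟨b, hb, rfl⟩ := β.ofGood_surjective
    refine ofGood_eq ((ha.ast hb).act t h) ((ha.act t h).ast (hb.act t h)) (.of_eq ?_)
    have h1 : t * (t⁻¹ * (e.val * t)) = e.val * t := by
      calc t * (t⁻¹ * (e.val * t)) = t * t⁻¹ * e.val * t := by simp only [mul_assoc]
        _ = e.val * (t * t⁻¹ * t) := by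
            rw [← idem_comm e.idem (mul_inv_idem t)]; simp only [mul_assoc]
        _ = _ := by rw [mul_inv_mul]
    have h2 : t⁻¹ * (a.tgt * t) * t⁻¹ = t⁻¹ * a.tgt := by
      calc t⁻¹ * (a.tgt * t) * t⁻¹ = t⁻¹ * (a.tgt * (t * t⁻¹)) := by simp only [mul_assoc]
        _ = t⁻¹ * t * t⁻¹ * a.tgt := by
            rw [Q.ker_comm ha.ψ_tgt (mul_inv_idem t)]; simp only [mul_assoc]
        _ = _ := by rw [inv_mul_inv]
    refine (congrArg (EdgePath.wL t⁻¹) (EdgePath.wR_comp t _ _ _)).trans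
      ((EdgePath.wL_comp t⁻¹ _ _ _).trans (EdgePath.comp_eq ?_ ?_ _ _))
    · change _ = ((a.wR t).wL t⁻¹).wR (t⁻¹ * (b.src * t))
      rw [← EdgePath.wL_wR, EdgePath.wR_wR, EdgePath.wR_wR, hb.src_eq, h1]
    · change _ = ((b.wR t).wL t⁻¹).wL (t⁻¹ * (a.tgt * t))
      rw [EdgePath.wL_wL, h2, ← EdgePath.wL_wR, EdgePath.wL_wL]

theorem act_mul (s t : T) {f g : Idem T} (h1 : f.val = s⁻¹ * e.val * s)
    (h2 : g.val = t⁻¹ * f.val * t) (h3 : g.val = (s * t)⁻¹ * e.val * (s * t)) (α : Star Q e) :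
    act (s * t) h3 α = act t h2 (act s h1 α) := by
  obtain ⟨a, ha, rfl⟩ := α.ofGood_surjective
  refine ofGood_eq (ha.act (s * t) h3) ((ha.act s h1).act t h2) (.of_eq ?_)
  rw [mul_inv_rev', ← EdgePath.wL_wR s⁻¹ t, EdgePath.wL_wL, EdgePath.wR_wR]

theorem act_self (h : e.val = e.val⁻¹ * e.val * e.val) (α : Star Q e) : act e.val h α = α := by
  obtain ⟨a, ha, rfl⟩ := α.ofGood_surjective
  refine ofGood_eq (ha.act e.val h) ha (.of_eq ?_)
  rw [idem_inv e.idem, ha.wR_eq, ha.wL_eq]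

theorem act_of_eq {s t : T} (hst : s = t) {f : Idem T} (hs : f.val = s⁻¹ * e.val * s)
    (ht : f.val = t⁻¹ * e.val * t) (α : Star Q e) : act s hs α = act t ht α := by
  subst hst; rfl

/-- The range map `star_e^⋈ → K_e`. -/
def range : Star Q e →* Ker Q e where
  toFun α := ⟨α.val.tgt, by
    obtain ⟨a, ha, rfl⟩ := α.ofGood_surjective
    exact ha.ψ_tgt⟩
  map_one' := rfl
  map_mul' α β := by
    obtain ⟨a, ha, rfl⟩ := α.ofGood_surjective
    obtain ⟨b, hb, rfl⟩ := β.ofGood_surjective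
    rfl

theorem range_surjective : Function.Surjective (range (Q := Q) (e := e)) := by
  intro k
  obtain ⟨a, h1, h2⟩ := EdgePath.exists_path (Q := Q) k.ψ_val.symm
  refine ⟨⟨((Arrow.mk a).wR e.val).wL e.val, Arrow.mk a, h1, rfl⟩, Ker.ext ?_⟩
  change e.val * (a.tgt * e.val) = k.val
  rw [h2, Q.mul_idem_of_ker k.ψ_val, Q.idem_mul_of_ker k.ψ_val]

theorem range_act (t : T) {f : Idem T} (h : f.val = t⁻¹ * e.val * t) (α : Star Q e) :
    range (act t h α) = Ker.conj t h (range α) := by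
  obtain ⟨a, ha, rfl⟩ := α.ofGood_surjective
  exact Ker.ext (mul_assoc _ _ _).symm

theorem conj_range (β : Star Q e) :
    e.val = (range β).val⁻¹ * e.val * (range β).val := by
  rw [mul_assoc, Q.idem_mul_of_ker (range β).ψ_val, Q.inv_mul_of_ker (range β).ψ_val]

/-- The crossed module identity `α ∗ β = β ∗ α^{r(β)}`. -/
theorem mul_eq_mul_act (α β : Star Q e) :
    α * β = β * act (range β).val (conj_range β) α := by
  have hc := conj_range β
  obtain ⟨a, ha, rfl⟩ := α.ofGood_surjective
  obtain ⟨b, hb, rfl⟩ := β.ofGood_surjective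
  refine ofGood_eq (ha.ast hb) (hb.ast (ha.act b.tgt hc)) ((EdgePath.interchange a b).trans
    (.of_eq ?_))
  refine EdgePath.comp_eq ?_ ?_ _ _
  · change _ = b.wR (b.tgt⁻¹ * (a.src * b.tgt))
    rw [ha.src_eq, hb.wL_eq, Q.idem_mul_of_ker hb.ψ_tgt, Q.inv_mul_of_ker hb.ψ_tgt, hb.wR_eq]
  · rw [EdgePath.wL_wL, Q.mul_inv_of_ker hb.ψ_tgt, EdgePath.wL_wR, ha.wL_eq]

theorem act_congr (s t : T) {f : Idem T} (hs : f.val = s⁻¹ * e.val * s)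
    (ht : f.val = t⁻¹ * e.val * t) (hst : Q.ψ s = Q.ψ t) (α : Star Q e) :
    ∃ β : Star Q f, act s hs α * β = β * act t ht α := by
  obtain ⟨β, hβ⟩ := range_surjective (Ker.diff (Q := Q) s t hs hst)
  refine ⟨β, (mul_eq_mul_act _ β).trans (congrArg (β * ·) ?_)⟩
  have hst' := Q.mul_inv_eq hst
  have hv : (range β).val = s⁻¹ * e.val * t := congrArg Ker.val hβ
  have hc : f.val = (s⁻¹ * e.val * t)⁻¹ * f.val * (s⁻¹ * e.val * t) := by
    rw [← hv]; exact conj_range β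
  rw [act_of_eq hv (conj_range β) hc]
  obtain ⟨a, ha, rfl⟩ := α.ofGood_surjective
  refine ofGood_eq ((ha.act s hs).act _ hc) (ha.act t ht) (.of_eq ?_)
  have h1 : s * (s⁻¹ * e.val * t) = e.val * t := by
    calc s * (s⁻¹ * e.val * t) = s * s⁻¹ * e.val * t := by simp only [mul_assoc]
      _ = e.val * (t * t⁻¹ * t) := by
          rw [← idem_comm e.idem (mul_inv_idem s), hst']; simp only [mul_assoc]
      _ = _ := by rw [mul_inv_mul]
  have h2 : (s⁻¹ * e.val * t)⁻¹ * s⁻¹ = t⁻¹ * e.val := by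
    rw [← mul_inv_rev', h1, mul_inv_rev', idem_inv e.idem]
  rw [← EdgePath.wL_wR, EdgePath.wL_wL, EdgePath.wR_wR, h1, h2]
  rw [← EdgePath.wR_wR, EdgePath.wL_wR, EdgePath.wL_wR, ← EdgePath.wL_wL]
  rw [ha.wL_eq, ← EdgePath.wL_wR t⁻¹ e.val, ha.wR_eq, ← EdgePath.wL_wR]

end Star

/-- The group `π_e^⋈` of the elements of `star_e^⋈` with range `e`. -/
def IdentityGroup (e : Idem T) : Subgroup (Star Q e) where
  carrier := {α | α.val.tgt = e.val}
  one_mem' := rfl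
  mul_mem' {α β} hα hβ := by
    have h := congrArg Ker.val (map_mul Star.range α β)
    change (α * β).val.tgt = α.val.tgt * β.val.tgt at h
    change (α * β).val.tgt = e.val
    rw [h, show α.val.tgt = e.val from hα, show β.val.tgt = e.val from hβ, e.idem]
  inv_mem' {α} hα := by
    have h := congrArg Ker.val (map_inv Star.range α)
    change α⁻¹.val.tgt = α.val.tgt⁻¹ at h
    change α⁻¹.val.tgt = e.val
    rw [h, show α.val.tgt = e.val from hα, idem_inv e.idem]

namespace IdentityGroup

variable {Q} {e : Idem T}

theorem central {α : Star Q e} (hα : α ∈ Q.IdentityGroup e) (β : Star Q e) : β * α = α * β := by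
  have hv : (Star.range α).val = e.val := hα
  have hc : e.val = e.val⁻¹ * e.val * e.val := by rw [idem_inv e.idem, e.idem, e.idem]
  rw [Star.mul_eq_mul_act β α, Star.act_of_eq hv _ hc, Star.act_self]

instance : CommGroup (Q.IdentityGroup e) :=
  { (inferInstance : Group (Q.IdentityGroup e)) with
    mul_comm := fun α β => Subtype.ext (central β.2 α.1) }

/-- The map `α ↦ t⁻¹ ▷ α ◁ t` on the groups `π_e^⋈`. -/
def act (t : T) {f : Idem T} (h : f.val = t⁻¹ * e.val * t) :
    Q.IdentityGroup e →* Q.IdentityGroup f :=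
  ((Star.act t h).comp (Q.IdentityGroup e).subtype).codRestrict (Q.IdentityGroup f) fun α => by
    have h1 := congrArg Ker.val (Star.range_act t h α.1)
    change (Star.act t h α.1).val.tgt = t⁻¹ * α.1.val.tgt * t at h1
    change (Star.act t h α.1).val.tgt = f.val
    rw [h1, show α.1.val.tgt = e.val from α.2, h]

end IdentityGroup

/-! ### The modules and the maps of the exact sequence -/

/-- The action of `T` on the groups `π_e^⋈`. -/
def identityAction : GradedAction T fun e => Additive (Q.IdentityGroup e) where
  act t {_ _} h := MonoidHom.toAdditive (IdentityGroup.act t h)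
  act_mul s t {e f g} h1 h2 h3 a := by
    induction a using Additive.rec with | _ a
    exact congrArg Additive.ofMul (Subtype.ext (Star.act_mul s t h1 h2 h3 a.1))
  act_self e h a := by
    induction a using Additive.rec with | _ a
    exact congrArg Additive.ofMul (Subtype.ext (Star.act_self h a.1))

theorem identityAction_congr (s t : T) {e f : Idem T} (hs : f.val = s⁻¹ * e.val * s)
    (ht : f.val = t⁻¹ * e.val * t) (hst : Q.ψ s = Q.ψ t) (a : Additive (Q.IdentityGroup e)) :
    Q.identityAction.act s hs a = Q.identityAction.act t ht a := by
  induction a using Additive.rec with | _ a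
  refine congrArg Additive.ofMul (Subtype.ext ?_)
  obtain ⟨β, hβ⟩ := Star.act_congr s t hs ht hst a.1
  change Star.act s hs a.1 = Star.act t ht a.1
  have h := IdentityGroup.central (IdentityGroup.act s hs a).2 β
  change β * Star.act s hs a.1 = Star.act s hs a.1 * β at h
  rw [← h] at hβ
  exact mul_left_cancel hβ

/-- The module `⊔ π_e^⋈`, with the action `α ◁ m = t⁻¹ ▷ α ◁ t` for any `t` over `m`. -/
noncomputable def identityModule : LauschModule.{v, max u w} M :=
  (Q.descend Q.identityAction Q.identityAction_congr).toModule

/-- The abelianised groups `(star_e^⋈)^ab`. -/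
abbrev StarAb (e : Idem T) : Type (max u w) := Additive (Abelianization (Star Q e))

/-- The action of `T` on the groups `(star_e^⋈)^ab`. -/
def starAction : GradedAction T Q.StarAb where
  act t {_ _} h := MonoidHom.toAdditive (Abelianization.map (Star.act t h))
  act_mul s t {e f g} h1 h2 h3 a := by
    induction a using Additive.rec with | _ a
    induction a using QuotientGroup.induction_on with | _ k
    exact congrArg (fun k => Additive.ofMul (Abelianization.of k)) (Star.act_mul s t h1 h2 h3 k)
  act_self e h a := by
    induction a using Additive.rec with | _ a
    induction a using QuotientGroup.induction_on with | _ k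
    exact congrArg (fun k => Additive.ofMul (Abelianization.of k)) (Star.act_self h k)

theorem starAction_congr (s t : T) {e f : Idem T} (hs : f.val = s⁻¹ * e.val * s)
    (ht : f.val = t⁻¹ * e.val * t) (hst : Q.ψ s = Q.ψ t) (a : Q.StarAb e) :
    Q.starAction.act s hs a = Q.starAction.act t ht a := by
  induction a using Additive.rec with | _ a
  induction a using QuotientGroup.induction_on with | _ k
  obtain ⟨β, hβ⟩ := Star.act_congr s t hs ht hst k
  exact congrArg Additive.ofMul (of_eq_of_conj hβ)

/-- The module `(S^⋈)^ab`, with the action induced by `α ↦ t⁻¹ ▷ α ◁ t` for any `t` over `m`. -/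
noncomputable def starModule : LauschModule.{v, max u w} M :=
  (Q.descend Q.starAction Q.starAction_congr).toModule

/-- A family of homomorphisms that commutes with the action of `T` gives a homomorphism of
`M`-modules. -/
noncomputable def descendHom {A : Idem T → Type w'} [∀ e, AddCommGroup (A e)]
    {B : Idem T → Type w''} [∀ e, AddCommGroup (B e)]
    (α : GradedAction T A) (hα) (β : GradedAction T B) (hβ) (φ : ∀ e, A e →+ B e)
    (hφ : ∀ (t : T) {e f : Idem T} (h : f.val = t⁻¹ * e.val * t) (a : A e),
      φ f (α.act t h a) = β.act t h (φ e a)) :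
    LauschModule.Hom (Q.descend α hα).toModule (Q.descend β hβ).toModule where
  app e := φ (Q.lift e)
  map_res _ a := hφ _ _ a
  map_act := by
    rintro ⟨e, a⟩ s
    exact congrArg (Sigma.mk (β := fun e => B (Q.lift e)) (e.conj s)) (hφ _ _ a)

/-- The map `⊔ π_e^⋈ → (S^⋈)^ab` induced by the inclusions `π_e^⋈ ⊆ star_e^⋈`. -/
noncomputable def inclusionHom : LauschModule.Hom Q.identityModule Q.starModule :=
  Q.descendHom Q.identityAction Q.identityAction_congr Q.starAction Q.starAction_congr
    (fun e => MonoidHom.toAdditive (Abelianization.of.comp (Q.IdentityGroup e).subtype))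
    (fun _ _ _ _ _ => rfl)

/-- The map `(S^⋈)^ab → ⊔ K_e^ab` induced by the range maps `star_e^⋈ → K_e`. -/
noncomputable def rangeHom : LauschModule.Hom Q.starModule Q.kerModule :=
  Q.descendHom Q.starAction Q.starAction_congr Q.kerAction Q.kerAction_congr
    (fun _ => MonoidHom.toAdditive (Abelianization.map Star.range))
    (fun t {e f} h a => by
      induction a using Additive.rec with | _ a
      induction a using QuotientGroup.induction_on with | _ k
      exact congrArg (fun k => Additive.ofMul (Abelianization.of k)) (Star.range_act t h k))

end SepQuotient

namespace InvPresentation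

variable {X : Type u} {M : Type v} [InverseMonoid M] (P : InvPresentation X M)

/-- The relation module `𝒦` of the presentation. -/
noncomputable def relationModule : LauschModule.{v, u} M := P.sep.kerModule

/-- The module of identities `⊔ π_e^⋈` of the presentation. -/
noncomputable def moduleOfIdentities : LauschModule.{v, u} M := P.sep.identityModule

/-- The abelianised crossed module `(S^⋈)^ab` of the presentation. -/
noncomputable def squierModule : LauschModule.{v, u} M := P.sep.starModule

/-- The map from the module of identities to `(S^⋈)^ab`. -/
noncomputable def inclusion : LauschModule.Hom P.moduleOfIdentities P.squierModule :=
  P.sep.inclusionHom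

/-- The map from `(S^⋈)^ab` to the relation module that is induced by the range map. -/
noncomputable def rangeMap : LauschModule.Hom P.squierModule P.relationModule := P.sep.rangeHom

end InvPresentation

end Modules

/-!
Give the edge `(p, l, r, q)` of the Squier complex the weight `((l, r), qψ)` in a free abelian
group. The total weight of a path is a homotopy invariant, and the loops `(l⁻¹, l, r, l⁻¹l) ◁ t`,
which generate the groups `star_e^⋈`, have distinct basis elements as their weights. Hence their
classes form a basis of `(S^⋈)^ab`.

The kernel `π_e^⋈` of `star_e^⋈ → K_e` is central, so it meets the commutator subgroup trivially as
soon as this surjection splits, and then the sequence is exact on the left. It splits because `K_e`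
is projective in the category of groups, by a wreath product argument in the style of Kaluzhnin and
Krasner. The monoid `𝒯` acts by monomial matrices over `K_e` on the vertices of the Schützenberger
graph of `M` at `eψ`, and lifting their entries along a surjection `f : G → K_e` gives an
idempotent-separating extension of `𝒯`. This extension has a section, since `FIM(X)` is free and
`θ_min` is the least congruence with its trace, and a section of it yields one of `f`.
-/

open InverseMonoid LauschModule

/-! ### Free modules -/

theorem freeAbelianGroup_map_injective {α : Type u} {β : Type v} {f : α → β}
    (hf : Function.Injective f) : Function.Injective (FreeAbelianGroup.map f) := by
  classical
  let r : FreeAbelianGroup β →+ FreeAbelianGroup α :=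
    FreeAbelianGroup.lift fun b => (Function.partialInv f b).elim 0 .of
  have hr : r.comp (FreeAbelianGroup.map f) = AddMonoidHom.id _ :=
    FreeAbelianGroup.lift_ext _ _ fun a => by
      simp only [r, AddMonoidHom.comp_apply, FreeAbelianGroup.map_of_apply,
        FreeAbelianGroup.lift_apply_of, Function.partialInv_left hf, Option.elim_some,
        AddMonoidHom.id_apply]
  exact Function.LeftInverse.injective (DFunLike.congr_fun hr)

theorem Idem.dom_le_iff {S : Type u} [InverseMonoid S] {s : S} {e : Idem S} :
    Idem.dom s ≤ e ↔ e.val * s = s := by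
  rw [Idem.le_def]
  constructor
  · intro (h : s * s⁻¹ = e.val * (s * s⁻¹))
    rw [← mul_inv_mul s, ← mul_assoc, ← h]
  · intro h
    rw [Idem.dom, ← mul_assoc, h]

theorem LauschModule.FreeBasis.val_eq_conj {S : Type u} [InverseMonoid S] {B : Idem S → Type w}
    {e : Idem S} (x : FreeBasis B e) : e.val = x.elt⁻¹ * x.gen.1.val * x.elt := by
  rw [mul_assoc, Idem.dom_le_iff.1 x.dom_le]
  exact congrArg Idem.val x.ran_eq.symm

namespace GradedAction

variable {S : Type u} [InverseMonoid S] {A : Idem S → Type w'} [∀ e, AddCommGroup (A e)]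
  {B : Idem S → Type w} (α : GradedAction S A) (b : ∀ f, B f → A f)

/-- The extension to the free module on `B` of a family of maps `b : B_f → A_f`, given by
`(x, s) ↦ b(x) ◁ s`. -/
noncomputable def freeLift (e : Idem S) : FreeAbelianGroup (FreeBasis B e) →+ A e :=
  FreeAbelianGroup.lift fun x => α.act x.elt x.val_eq_conj (b x.gen.1 x.gen.2)

theorem freeLift_of {e : Idem S} (x : FreeBasis B e) :
    α.freeLift b e (.of x) = α.act x.elt x.val_eq_conj (b x.gen.1 x.gen.2) :=
  FreeAbelianGroup.lift_apply_of _ _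

theorem freeLift_act (s : S) {e f : Idem S} (h : f.val = s⁻¹ * e.val * s)
    (a : FreeAbelianGroup (FreeBasis B e)) :
    α.freeLift b f ((freeAction B).act s h a) = α.act s h (α.freeLift b e a) := by
  have hcomp : (α.freeLift b f).comp ((freeAction B).act s h) =
      (α.act s h).comp (α.freeLift b e) := FreeAbelianGroup.lift_ext _ _ fun x => by
    simp only [AddMonoidHom.comp_apply, freeAction, FreeAbelianGroup.map_of_apply, freeLift_of]
    exact α.act_mul ..
  exact DFunLike.congr_fun hcomp a

theorem isFree_of_bijective_freeLift (hb : ∀ e, Function.Bijective (α.freeLift b e)) :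
    IsFree.{u, w, w'} α.toModule := by
  let coord (e : Idem S) : A e ≃+ FreeAbelianGroup (FreeBasis B e) :=
    (AddEquiv.ofBijective (α.freeLift b e) (hb e)).symm
  have coord_act (s : S) {e f : Idem S} (h : f.val = s⁻¹ * e.val * s) (a : A e) :
      coord f (α.act s h a) = (freeAction B).act s h (coord e a) := by
    refine (hb f).injective ?_
    rw [freeLift_act]
    exact ((coord f).symm_apply_apply _).trans
      (congrArg (α.act s h) ((coord e).symm_apply_apply a).symm)
  refine ⟨B, ⟨fun e => (coord e).toAddMonoidHom, fun h a => coord_act _ _ a, ?_⟩,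
    fun e => (coord e).bijective⟩
  rintro ⟨e, a⟩ s
  exact congrArg (Sigma.mk (β := fun e => FreeAbelianGroup (FreeBasis B e)) (e.conj s))
    (coord_act s _ a)

end GradedAction

/-! ### Weights -/

namespace SepQuotient

variable {ι : Type w} {T : Type u} {M : Type v} [InverseMonoid T] [InverseMonoid M]
  (Q : SepQuotient ι T M)

theorem ψ_lhs (i : ι) : Q.ψ (Q.lhs i) = Q.ψ (Q.rhs i) := by
  have h : Con.ker Q.ψ (Q.lhs i) (Q.rhs i) := by
    rw [Q.ker_eq]
    exact ConGen.Rel.of _ _ ⟨i, rfl, rfl⟩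
  exact h

variable {Q}

/-- The weight `±(i, ψ q)` of the edge `(p, l_i, r_i, q)`, the sign being its orientation. -/
def Edge.weight (s : Edge Q) : FreeAbelianGroup (ι × M) :=
  bif s.fwd then .of (s.rel, Q.ψ s.q) else -.of (s.rel, Q.ψ s.q)

theorem Edge.weight_symm (s : Edge Q) : s.symm.weight = -s.weight := by
  rcases s with ⟨p, i, q, _ | _⟩
  · exact (neg_neg _).symm
  · rfl

/-- The sum of the weights of the edges of a path. It is a homotopy invariant, because the left
factor `p` of an edge does not enter into its weight and `ψ` identifies both sides of a relation. -/
def EdgePath.weight (a : EdgePath Q) : FreeAbelianGroup (ι × M) :=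
  (a.steps.map Edge.weight).sum

theorem EdgePath.weight_wL (x : T) (a : EdgePath Q) : (a.wL x).weight = a.weight :=
  congrArg List.sum List.map_map

theorem EdgePath.weight_comp (a b : EdgePath Q) (h : a.tgt = b.src) :
    (comp a b h).weight = a.weight + b.weight := by
  simp only [weight, comp, List.map_append, List.sum_append]

theorem EdgePath.Step.weight_eq {a b : EdgePath Q} (h : Step a b) : a.weight = b.weight := by
  obtain ⟨-, -, h⟩ := h
  unfold weight
  generalize a.steps = L, b.steps = L' at h
  cases h with
  | cancel U V s =>
    simp only [List.map_append, List.map_cons, List.sum_append, List.sum_cons, Edge.weight_symm,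
      add_neg_cancel_left]
  | square U V p q p' q' i j =>
    simp only [List.map_append, List.map_cons, List.sum_append, List.sum_cons, Edge.weight,
      cond_true, map_mul, Q.ψ_lhs]
    rw [add_left_comm (FreeAbelianGroup.of (i, _))]

/-- The weight of an arrow of the fundamental groupoid. -/
def Arrow.weight : Arrow Q → FreeAbelianGroup (ι × M) :=
  Quot.lift EdgePath.weight fun _ _ => EdgePath.Step.weight_eq

namespace Star

variable {e : Idem T}

/-- The weight as a homomorphism on `star_e^⋈`. -/
def weight : Star Q e →* Multiplicative (FreeAbelianGroup (ι × M)) where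
  toFun α := .ofAdd α.val.weight
  map_one' := rfl
  map_mul' α β := by
    obtain ⟨a, ha, rfl⟩ := α.ofGood_surjective
    obtain ⟨b, hb, rfl⟩ := β.ofGood_surjective
    refine congrArg Multiplicative.ofAdd (?_ : (a.ast b).weight = a.weight + b.weight)
    calc (a.ast b).weight = (a.wR b.src).weight + (b.wL a.tgt).weight :=
          EdgePath.weight_comp _ _ _
      _ = a.weight + b.weight := by rw [hb.src_eq, ha.wR_eq, EdgePath.weight_wL]

end Star

end SepQuotient

/-! ### Generators of the groups `star_e^⋈` -/

theorem list_map_eq_self_iff {α : Type u} {f : α → α} {l : List α} :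
    l.map f = l ↔ ∀ a ∈ l, f a = a := by
  rw [← List.map_inj_left (g := fun a => a), List.map_id']

namespace InverseMonoid

variable {S : Type u} [InverseMonoid S]

theorem eq_inv_of_mul_eq {e a b : S} (h : a * b = e) (ha : e * a = a) (hb : b * e = b) :
    a = b⁻¹ :=
  inv_unique b a (by rw [mul_assoc, h, hb]) (by rw [h, ha])

theorem inv_mul_self_mul_of_mul_eq {e p l q : S} (h : p * l * q = e) (hp : e * p = p)
    (hq : q * e = q) : l⁻¹ * l * q = q := by
  have hpl : p * l = q⁻¹ := eq_inv_of_mul_eq h (by rw [← mul_assoc, hp]) hq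
  have hq' : q = l⁻¹ * p⁻¹ := by rw [← mul_inv_rev', hpl, inv_inv']
  rw [hq', ← mul_assoc, inv_mul_inv]

end InverseMonoid

namespace SepQuotient

variable {ι : Type w} {T : Type u} {M : Type v} [InverseMonoid T] [InverseMonoid M]
  {Q : SepQuotient ι T M}

namespace EdgePath

theorem wL_single (x : T) (s : Edge Q) : (single s).wL x = single (s.wL x) :=
  EdgePath.ext (s.src_wL x).symm (s.tgt_wL x).symm rfl

theorem wR_single (x : T) (s : Edge Q) : (single s).wR x = single (s.wR x) :=
  EdgePath.ext (s.src_wR x).symm (s.tgt_wR x).symm rfl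

theorem rev_single (s : Edge Q) : (single s).rev = single s.symm :=
  EdgePath.ext s.src_symm.symm s.tgt_symm.symm rfl

theorem wL_eq_self_iff {x : T} {a : EdgePath Q} :
    a.wL x = a ↔ x * a.src = a.src ∧ x * a.tgt = a.tgt ∧ ∀ s ∈ a.steps, x * s.p = s.p := by
  rw [EdgePath.ext_iff]
  refine and_congr .rfl (and_congr .rfl (list_map_eq_self_iff.trans ?_))
  exact forall₂_congr fun s _ => ⟨congrArg Edge.p, fun h => Edge.ext h rfl rfl rfl⟩

theorem wR_eq_self_iff {x : T} {a : EdgePath Q} :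
    a.wR x = a ↔ a.src * x = a.src ∧ a.tgt * x = a.tgt ∧ ∀ s ∈ a.steps, s.q * x = s.q := by
  rw [EdgePath.ext_iff]
  refine and_congr .rfl (and_congr .rfl (list_map_eq_self_iff.trans ?_))
  exact forall₂_congr fun s _ => ⟨congrArg Edge.q, fun h => Edge.ext rfl rfl h rfl⟩

end EdgePath

namespace Star

variable {e : Idem T}

theorem good_iff {a : EdgePath Q} :
    Good e a ↔ a.src = e.val ∧ ∀ s ∈ a.steps, e.val * s.p = s.p ∧ s.q * e.val = s.q := by
  constructor
  · intro h
    exact ⟨h.src_eq, fun s hs => ⟨(EdgePath.wL_eq_self_iff.1 h.wL_eq).2.2 s hs,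
      (EdgePath.wR_eq_self_iff.1 h.wR_eq).2.2 s hs⟩⟩
  · rintro ⟨hsrc, hsteps⟩
    have htgt : Q.ψ a.tgt = Q.ψ e.val := by rw [← a.ψ_src, hsrc]
    exact ⟨hsrc,
      EdgePath.wL_eq_self_iff.2 ⟨by rw [hsrc, e.idem], Q.idem_mul_of_ker htgt,
        fun s hs => (hsteps s hs).1⟩,
      EdgePath.wR_eq_self_iff.2 ⟨by rw [hsrc, e.idem], Q.mul_idem_of_ker htgt,
        fun s hs => (hsteps s hs).2⟩⟩

theorem good_single_iff {s : Edge Q} :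
    Good e (EdgePath.single s) ↔ s.src = e.val ∧ e.val * s.p = s.p ∧ s.q * e.val = s.q := by
  rw [good_iff]
  simp only [EdgePath.single, List.mem_singleton, forall_eq]

section Comp

variable {a b : EdgePath Q} {h : a.tgt = b.src}

theorem Good.of_comp_left (hab : Good e (a.comp b h)) : Good e a :=
  good_iff.2 ⟨hab.src_eq, fun s hs =>
    (good_iff.1 hab).2 s (List.mem_append_left b.steps hs)⟩

theorem Good.of_comp_right (hab : Good e (a.comp b h)) : Good e (b.wL a.tgt⁻¹) := by
  have ha : Q.ψ a.tgt = Q.ψ e.val := hab.of_comp_left.ψ_tgt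
  refine good_iff.2 ⟨?_, fun s hs => ?_⟩
  · change a.tgt⁻¹ * b.src = e.val
    rw [← h, Q.inv_mul_of_ker ha]
  · obtain ⟨s, hsb, rfl⟩ := List.mem_map.1 hs
    refine ⟨?_, ((good_iff.1 hab).2 s (List.mem_append_right a.steps hsb)).2⟩
    change e.val * (a.tgt⁻¹ * s.p) = a.tgt⁻¹ * s.p
    rw [← mul_assoc, Q.idem_mul_of_ker (ker_inv ha)]

theorem ofGood_comp (hab : Good e (a.comp b h)) :
    ofGood _ hab = ofGood a hab.of_comp_left * ofGood _ hab.of_comp_right := by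
  have ha := hab.of_comp_left
  have hb : b.wL e.val = b := EdgePath.wL_eq_self_iff.2
    ⟨by rw [← h, Q.idem_mul_of_ker ha.ψ_tgt], Q.idem_mul_of_ker hab.ψ_tgt,
      fun s hs => ((good_iff.1 hab).2 s (List.mem_append_right a.steps hs)).1⟩
  refine ofGood_eq hab (ha.ast hab.of_comp_right) (.of_eq (EdgePath.comp_eq ?_ ?_ _ _))
  · rw [hab.of_comp_right.src_eq, ha.wR_eq]
  · rw [EdgePath.wL_wL, Q.mul_inv_of_ker ha.ψ_tgt, hb]

end Comp

theorem good_rel (i : ι) (he : e.val = (Q.lhs i)⁻¹ * Q.lhs i) :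
    Good e (EdgePath.single (Q := Q) ⟨(Q.lhs i)⁻¹, i, e.val, true⟩) :=
  good_single_iff.2 ⟨(congrArg (· * e.val) he.symm).trans e.idem, by rw [he, inv_mul_inv], e.idem⟩

/-- The element of `star_e^⋈` over `e = l⁻¹l` represented by the edge `(l⁻¹, l, r, e)`. -/
def ofRel (i : ι) (he : e.val = (Q.lhs i)⁻¹ * Q.lhs i) : Star Q e :=
  ofGood _ (good_rel i he)

theorem exists_eq_act_ofRel {s : Edge Q} (hs : Good e (EdgePath.single s)) (hfwd : s.fwd = true) :
    ∃ h : e.val = s.q⁻¹ * (Idem.ran (Q.lhs s.rel)).val * s.q,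
      ofGood _ hs = act s.q h (ofRel s.rel rfl) := by
  rcases s with ⟨p, i, q, _ | _⟩
  · cases hfwd
  obtain ⟨hsrc, hp, hq⟩ := good_single_iff.1 hs
  replace hsrc : p * Q.lhs i * q = e.val := hsrc
  have hp_eq : p = q⁻¹ * (Q.lhs i)⁻¹ := by
    rw [← mul_inv_rev']
    exact eq_inv_of_mul_eq (by rw [← mul_assoc, hsrc]) hp (by rw [mul_assoc, hq])
  have h : e.val = q⁻¹ * (Idem.ran (Q.lhs i)).val * q := by
    rw [← hsrc, hp_eq]
    simp only [Idem.ran, mul_assoc]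
  refine ⟨h, ofGood_eq hs ((good_rel i rfl).act q h) (.of_eq ?_)⟩
  rw [EdgePath.wR_single, EdgePath.wL_single]
  exact congrArg EdgePath.single
    (Edge.ext hp_eq rfl (inv_mul_self_mul_of_mul_eq hsrc hp hq).symm rfl)

theorem eq_top_of_ofGood_single_mem {H : Subgroup (Star Q e)}
    (hH : ∀ s, ∀ h : Good e (EdgePath.single s), ofGood _ h ∈ H) : H = ⊤ := by
  have path (a : EdgePath Q) : ∀ x, ∀ h : Good e (a.wL x), ofGood _ h ∈ H := by
    induction a using EdgePath.induct with
    | h0 y =>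
      intro x h
      have hconst : EdgePath.const e.val = (EdgePath.const (Q := Q) y).wL x :=
        EdgePath.ext h.src_eq.symm h.src_eq.symm rfl
      exact ofGood_eq good_const h (.of_eq hconst) ▸ H.one_mem
    | h1 s =>
      intro x
      rw [EdgePath.wL_single]
      exact hH _
    | h2 a b hab iha ihb =>
      intro x
      rw [EdgePath.wL_comp]
      intro h
      have hb := h.of_comp_right
      rw [EdgePath.wL_wL] at hb
      exact ofGood_comp h ▸ mul_mem (iha x _)
        (ofGood_eq hb h.of_comp_right (.of_eq (EdgePath.wL_wL _ _ _).symm) ▸ ihb _ hb)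
  refine (Subgroup.eq_top_iff' H).2 fun α => ?_
  obtain ⟨a, ha, rfl⟩ := α.ofGood_surjective
  have ha' : Good e (a.wL e.val) := ha.wL_eq.symm ▸ ha
  exact ofGood_eq ha' ha (.of_eq ha.wL_eq) ▸ path a e.val ha'

theorem eq_top_of_act_ofRel_mem {H : Subgroup (Star Q e)}
    (hH : ∀ i q (h : e.val = q⁻¹ * (Idem.ran (Q.lhs i)).val * q), act q h (ofRel i rfl) ∈ H) :
    H = ⊤ := by
  have forward {s : Edge Q} (hfwd : s.fwd = true) (hs : Good e (EdgePath.single s)) :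
      ofGood _ hs ∈ H := by
    obtain ⟨h, hact⟩ := exists_eq_act_ofRel hs hfwd
    exact hact ▸ hH _ _ h
  refine eq_top_of_ofGood_single_mem fun s hs => ?_
  cases hfwd : s.fwd with
  | true => exact forward hfwd hs
  | false =>
    refine inv_mem_iff.1 (?_ : ofGood _ hs.inv ∈ H)
    have hinv := hs.inv
    simp only [EdgePath.rev_single, EdgePath.wR_single, EdgePath.wL_single] at hinv ⊢
    exact forward (by simp only [Edge.wL, Edge.wR, Edge.symm, hfwd, Bool.not_false]) hinv

end Star

end SepQuotient

/-! ### Freeness of `(S^⋈)^ab` -/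

namespace SepQuotient

variable {ι : Type w} {T : Type u} {M : Type v} [InverseMonoid T] [InverseMonoid M]
  (Q : SepQuotient ι T M)

/-- The family of sets on which `(S^⋈)^ab` is free: the relation `l = r` lies over the idempotent
`l⁻¹l` of `M`. -/
structure RelGen (f : Idem M) : Type w where
  rel : ι
  ran_lhs : Idem.ran (Q.ψ (Q.lhs rel)) = f

variable {Q}

theorem RelGen.lift_val {f : Idem M} (x : Q.RelGen f) :
    (Q.lift f).val = (Q.lhs x.rel)⁻¹ * Q.lhs x.rel := by
  refine Q.idem_eq (Q.lift f).idem (inv_mul_idem _) ?_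
  rw [Q.ψ_lift, map_mul, map_inv']
  exact congrArg Idem.val x.ran_lhs.symm

variable (Q) in
/-- The basis of `(S^⋈)^ab`, given by the edges `(l⁻¹, l, r, l⁻¹l)`. -/
noncomputable def relClass (f : Idem M) (x : Q.RelGen f) : Q.StarAb (Q.lift f) :=
  .ofMul (.of (Star.ofRel x.rel x.lift_val))

variable (Q) in
/-- The homomorphism from the free module to `(S^⋈)^ab` that extends `relClass`. -/
noncomputable def starLift (e : Idem M) :
    FreeAbelianGroup (FreeBasis Q.RelGen e) →+ Q.StarAb (Q.lift e) :=
  (Q.descend Q.starAction Q.starAction_congr).freeLift Q.relClass e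

variable (Q) in
/-- The homomorphism on `(star_e^⋈)^ab` induced by the weight. -/
def starAbWeight (e : Idem T) : Q.StarAb e →+ FreeAbelianGroup (ι × M) :=
  MonoidHom.toAdditiveLeft (Abelianization.lift Star.weight)

theorem Star.weight_act_ofRel {e f : Idem T} {i : ι} (he : e.val = (Q.lhs i)⁻¹ * Q.lhs i) {t : T}
    (h : f.val = t⁻¹ * e.val * t) :
    weight (act t h (ofRel i he)) = .ofAdd (.of (i, Q.ψ (e.val * t))) :=
  congrArg Multiplicative.ofAdd (add_zero _)

theorem starLift_injective (e : Idem M) : Function.Injective (Q.starLift e) := by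
  let index (x : FreeBasis Q.RelGen e) : ι × M := (x.gen.2.rel, x.elt)
  have hindex : Function.Injective index := by
    rintro ⟨⟨_, i, rfl⟩, m, _, _⟩ ⟨⟨_, j, rfl⟩, n, _, _⟩ h
    obtain ⟨rfl, rfl⟩ := Prod.ext_iff.1 h
    rfl
  have hcomp : (Q.starAbWeight _).comp (Q.starLift e) = FreeAbelianGroup.map index := by
    refine FreeAbelianGroup.lift_ext _ _ fun x => ?_
    rw [AddMonoidHom.comp_apply, starLift, GradedAction.freeLift_of,
      FreeAbelianGroup.map_of_apply]
    refine (congrArg Multiplicative.toAdd (Star.weight_act_ofRel x.gen.2.lift_val _)).trans ?_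
    rw [map_mul, Q.ψ_lift, Q.ψ_pick, Idem.dom_le_iff.1 x.dom_le]
    rfl
  refine Function.Injective.of_comp (f := Q.starAbWeight _) ?_
  rw [← AddMonoidHom.coe_comp, hcomp]
  exact freeAbelianGroup_map_injective hindex

theorem of_act_ofRel_mem_range_starLift {e : Idem M} {i : ι} {q : T} {f : Idem T}
    (hf : f.val = (Q.lhs i)⁻¹ * Q.lhs i) (h : (Q.lift e).val = q⁻¹ * f.val * q) :
    Additive.ofMul (Abelianization.of (Star.act q h (Star.ofRel i hf))) ∈ (Q.starLift e).range := by
  obtain rfl : f = Q.lift (Idem.ran (Q.ψ (Q.lhs i))) :=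
    Idem.ext (hf.trans (RelGen.lift_val ⟨i, rfl⟩).symm)
  let f := Q.lift (Idem.ran (Q.ψ (Q.lhs i)))
  have hran : (f.val * q)⁻¹ * (f.val * q) = (Q.lift e).val := by
    rw [h, mul_inv_rev', idem_inv f.idem, mul_assoc, ← mul_assoc f.val, f.idem, ← mul_assoc]
  let x : FreeBasis Q.RelGen e :=
    { gen := ⟨_, i, rfl⟩
      elt := Q.ψ (f.val * q)
      dom_le := by rw [Idem.dom_le_iff, ← Q.ψ_lift (Idem.ran _), ← map_mul, ← mul_assoc, f.idem]
      ran_eq := Idem.ext (by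
        simp only [Idem.ran]
        rw [← map_inv', ← map_mul, hran, Q.ψ_lift]) }
  refine ⟨.of x, (GradedAction.freeLift_of _ _ x).trans ?_⟩
  have hq : (Q.lift e).val = (f.val * q)⁻¹ * f.val * (f.val * q) := by
    rw [mul_assoc, ← mul_assoc f.val, f.idem, hran]
  exact (Q.starAction_congr _ _ _ hq (Q.ψ_pick _) _).trans
    (Q.starAction.act_of_eq (by rw [← mul_assoc, f.idem]) hq h _)

theorem starLift_surjective (e : Idem M) : Function.Surjective (Q.starLift e) := by
  let H : Subgroup (Star Q (Q.lift e)) :=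
    (AddSubgroup.toSubgroup' (Q.starLift e).range).comap Abelianization.of
  have hH : H = ⊤ := Star.eq_top_of_act_ofRel_mem fun i q h => of_act_ofRel_mem_range_starLift rfl h
  intro a
  induction a using Additive.rec with | _ a
  induction a using QuotientGroup.induction_on with | _ α
  exact (hH ▸ Subgroup.mem_top α : α ∈ H)

theorem starModule_isFree : LauschModule.IsFree.{v, w, max u w} Q.starModule :=
  GradedAction.isFree_of_bijective_freeLift _ Q.relClass fun e =>
    ⟨starLift_injective e, starLift_surjective e⟩

end SepQuotient

/-! ### Projectivity of `𝒯(M, X)` -/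

namespace FIM

variable {X : Type u} {S : Type v} [InverseMonoid S]

/-- The generator of the free inverse monoid that belongs to a letter. -/
def of (x : X) : FIM X := ofWord (.of (x, true))

theorem ofWord_of (x : X) (b : Bool) : ofWord (.of (x, b)) = bif b then of x else (of x)⁻¹ := by
  cases b <;> rfl

theorem hom_ext {f g : FIM X →* S} (h : ∀ x, f (of x) = g (of x)) : f = g := by
  have hofWord : f.comp ofWord = g.comp ofWord := FreeMonoid.hom_eq fun ⟨x, b⟩ => by
    cases b <;> simp only [MonoidHom.comp_apply, ofWord_of, cond_true, cond_false, map_inv', h]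
  exact (MonoidHom.cancel_right ofWord_surjective).1 hofWord

/-- The value of a word over `X ⊔ X⁻¹` when the letters of `X` are sent to elements of an inverse
monoid. -/
def evalWord (g : X → S) : FreeMonoid (X × Bool) →* S :=
  FreeMonoid.lift fun a => bif a.2 then g a.1 else (g a.1)⁻¹

theorem evalWord_invWord (g : X → S) (w : FreeMonoid (X × Bool)) :
    evalWord g (invWord w) = (evalWord g w)⁻¹ := by
  induction w using FreeMonoid.inductionOn' with
  | one => exact (idem_inv (mul_one 1)).symm
  | of_mul a w ih =>
    have hletter : evalWord g (invWord (.of a)) = (evalWord g (.of a))⁻¹ := by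
      rcases a with ⟨x, _ | _⟩
      · exact (inv_inv' (g x)).symm
      · rfl
    rw [invWord_mul, map_mul, map_mul, ih, hletter, mul_inv_rev']

theorem wagnerCon_le_ker_evalWord (g : X → S) : wagnerCon X ≤ Con.ker (evalWord g) := by
  rw [wagnerCon, Con.conGen_le]
  rintro _ _ (w | ⟨v, w⟩)
  · simp only [Con.ker_rel, map_mul, evalWord_invWord, mul_inv_mul]
  · simp only [Con.ker_rel, map_mul, evalWord_invWord]
    exact idem_comm (mul_inv_idem _) (mul_inv_idem _)

/-- The homomorphism from the free inverse monoid given by the images of its generators. -/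
def lift (g : X → S) : FIM X →* S :=
  (wagnerCon X).lift (evalWord g) (wagnerCon_le_ker_evalWord g)

theorem lift_of (g : X → S) (x : X) : lift g (of x) = g x := rfl

theorem exists_comp_eq {N : Type w} [InverseMonoid N] {π : N →* S} (hπ : Function.Surjective π)
    (f : FIM X →* S) : ∃ φ : FIM X →* N, π.comp φ = f := by
  choose g hg using fun x => hπ (f (of x))
  exact ⟨lift g, hom_ext fun x => by rw [MonoidHom.comp_apply, lift_of, hg]⟩

end FIM

theorem InvPresentation.exists_section_of_separating {X : Type u} {M : Type v} [InverseMonoid M]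
    (P : InvPresentation X M) {N : Type w} [InverseMonoid N] {π : N →* P.T}
    (hπ : Function.Surjective π) (hsep : ∀ e f : Idem N, π e.val = π f.val → e = f) :
    ∃ s : P.T →* N, ∀ t, π (s t) = t := by
  obtain ⟨φ, hφ⟩ := FIM.exists_comp_eq hπ P.τ
  have map_idem_eq : ∀ {a b : FIM X}, a * a = a → b * b = b → P.θ a = P.θ b → φ a = φ b := by
    intro a b ha hb h
    have hτ : P.τ a = P.τ b :=
      P.sep.idem_eq (by rw [← map_mul, ha]) (by rw [← map_mul, hb]) h
    refine congrArg Idem.val (hsep ⟨φ a, by rw [← map_mul, ha]⟩ ⟨φ b, by rw [← map_mul, hb]⟩ ?_)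
    rwa [← hφ] at hτ
  have hle : minCon P.θ ≤ Con.ker φ := by
    rintro a b ⟨e, hab, ha, hb⟩
    have hea : φ (a⁻¹ * a) = φ e.val := map_idem_eq (inv_mul_idem a) e.idem ha
    have heb : φ e.val = φ (b⁻¹ * b) := map_idem_eq e.idem (inv_mul_idem b) hb
    calc φ a = φ a * φ (a⁻¹ * a) := by rw [← map_mul, ← mul_assoc, mul_inv_mul]
      _ = φ b * φ (b⁻¹ * b) := by rw [hea, ← map_mul, hab, map_mul, heb]
      _ = φ b := by rw [← map_mul, ← mul_assoc, mul_inv_mul]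
  refine ⟨(minCon P.θ).lift φ hle, fun t => ?_⟩
  obtain ⟨a, rfl⟩ := P.τ_surjective t
  exact DFunLike.congr_fun hφ a

/-! ### Projectivity of the groups `K_e` -/

theorem InverseMonoid.mul_mul_mul_inv_eq_self_iff {S : Type u} [InverseMonoid S] {m a b : S} :
    m * (a * b) * (a * b)⁻¹ = m ↔ m * a * a⁻¹ = m ∧ m * a * b * b⁻¹ = m * a := by
  rw [mul_inv_rev']
  constructor
  · intro h
    constructor
    · calc m * a * a⁻¹ = m * (a * b) * (b⁻¹ * (a⁻¹ * a * a⁻¹)) := by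
            conv_lhs => rw [← h]
            simp only [mul_assoc]
        _ = m := by rw [inv_mul_inv, h]
    · calc m * a * b * b⁻¹ = m * (a * a⁻¹ * a) * (b * b⁻¹) := by
            rw [mul_inv_mul]; simp only [mul_assoc]
        _ = m * a * (a⁻¹ * a * (b * b⁻¹)) := by simp only [mul_assoc]
        _ = m * (a * b) * (b⁻¹ * a⁻¹) * a := by
            rw [idem_comm (inv_mul_idem a) (mul_inv_idem b)]; simp only [mul_assoc]
        _ = m * a := by rw [h]
  · rintro ⟨ha, hb⟩
    calc m * (a * b) * (b⁻¹ * a⁻¹) = m * a * b * b⁻¹ * a⁻¹ := by simp only [mul_assoc]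
      _ = m := by rw [hb, ha]

namespace SepQuotient

variable {ι : Type w} {T : Type u} {M : Type v} [InverseMonoid T] [InverseMonoid M]
  {Q : SepQuotient ι T M} {e : Idem T} {m : M} {t t' : T}

/-- The Schützenberger graph of `M` at `ψ(e)`: its vertices are the `m ∈ M` with `mm⁻¹ = ψ(e)`, and
`t ∈ T` labels an edge from `m` to `mψ(t)` if right multiplication by `ψ(t)` is invertible at `m`.
The predicate says that there is an edge labelled `t` at `m`. -/
def IsEdgeAt (Q : SepQuotient ι T M) (e : Idem T) (m : M) (t : T) : Prop :=
  m * m⁻¹ = Q.ψ e.val ∧ m * Q.ψ t * (Q.ψ t)⁻¹ = m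

theorem IsEdgeAt.mul_mul_inv (h : IsEdgeAt Q e m t) :
    m * Q.ψ t * (m * Q.ψ t)⁻¹ = Q.ψ e.val := by
  rw [mul_inv_rev', ← mul_assoc, h.2, h.1]

theorem isEdgeAt_one_iff : IsEdgeAt Q e m 1 ↔ m * m⁻¹ = Q.ψ e.val := by
  rw [IsEdgeAt, map_one, idem_inv (mul_one 1), mul_one, mul_one, and_iff_left rfl]

theorem isEdgeAt_mul_iff :
    IsEdgeAt Q e m (t * t') ↔ IsEdgeAt Q e m t ∧ IsEdgeAt Q e (m * Q.ψ t) t' := by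
  rw [IsEdgeAt, map_mul, mul_mul_mul_inv_eq_self_iff]
  exact ⟨fun h => ⟨⟨h.1, h.2.1⟩, IsEdgeAt.mul_mul_inv ⟨h.1, h.2.1⟩, h.2.2⟩,
    fun h => ⟨h.1.1, h.1.2, h.2.2⟩⟩

theorem isEdgeAt_inv_iff :
    IsEdgeAt Q e m t⁻¹ ↔ m * Q.ψ t⁻¹ * Q.ψ t = m ∧ IsEdgeAt Q e (m * Q.ψ t⁻¹) t := by
  have hcancel : m * Q.ψ t⁻¹ * Q.ψ t * (Q.ψ t)⁻¹ = m * Q.ψ t⁻¹ := by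
    rw [map_inv', mul_assoc m, mul_assoc m, inv_mul_inv]
  constructor
  · intro h
    have hm : m * Q.ψ t⁻¹ * Q.ψ t = m := by simpa only [map_inv', inv_inv'] using h.2
    exact ⟨hm, h.mul_mul_inv, hcancel⟩
  · rintro ⟨hm, h⟩
    refine ⟨?_, by rwa [map_inv' Q.ψ t, inv_inv', ← map_inv']⟩
    rw [← h.mul_mul_inv, hm]

/-- The element of `K_e` obtained by closing up the edge labelled `t` at `m` with the chosen
elements of `T` over its ends. -/
noncomputable def edgeLoop (h : IsEdgeAt Q e m t) : Ker Q e where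
  val := Q.pick m * t * (Q.pick (m * Q.ψ t))⁻¹
  ψ_val := by
    rw [map_mul, map_mul, map_inv', Q.ψ_pick, Q.ψ_pick, h.mul_mul_inv]

theorem edgeLoop_one (h : IsEdgeAt Q e m 1) : edgeLoop h = 1 := by
  refine Ker.ext (Q.idem_eq ?_ e.idem (edgeLoop h).ψ_val)
  simp only [edgeLoop, map_one, mul_one, mul_inv_idem]

theorem edgeLoop_mul (h : IsEdgeAt Q e m t) (h' : IsEdgeAt Q e (m * Q.ψ t) t')
    (hmul : IsEdgeAt Q e m (t * t')) : edgeLoop hmul = edgeLoop h * edgeLoop h' := by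
  have hpick : (Q.pick (m * Q.ψ t))⁻¹ * Q.pick (m * Q.ψ t) =
      (Q.pick m * t)⁻¹ * (Q.pick m * t) :=
    Q.inv_mul_eq (by rw [map_mul, Q.ψ_pick, Q.ψ_pick])
  refine Ker.ext (Eq.symm ?_)
  calc Q.pick m * t * (Q.pick (m * Q.ψ t))⁻¹ *
        (Q.pick (m * Q.ψ t) * t' * (Q.pick (m * Q.ψ t * Q.ψ t'))⁻¹)
      = Q.pick m * t * ((Q.pick (m * Q.ψ t))⁻¹ * Q.pick (m * Q.ψ t)) * t' *
          (Q.pick (m * Q.ψ t * Q.ψ t'))⁻¹ := by simp only [mul_assoc]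
    _ = Q.pick m * t * t' * (Q.pick (m * Q.ψ t * Q.ψ t'))⁻¹ := by
      rw [hpick, ← mul_assoc (Q.pick m * t), mul_inv_mul]
    _ = Q.pick m * (t * t') * (Q.pick (m * Q.ψ (t * t')))⁻¹ := by
      simp only [map_mul, mul_assoc]

theorem edgeLoop_inv (h : IsEdgeAt Q e m t⁻¹) (h' : IsEdgeAt Q e (m * Q.ψ t⁻¹) t) :
    edgeLoop h = (edgeLoop h')⁻¹ := by
  refine Ker.ext ?_
  change Q.pick m * t⁻¹ * (Q.pick (m * Q.ψ t⁻¹))⁻¹ =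
    (Q.pick (m * Q.ψ t⁻¹) * t * (Q.pick (m * Q.ψ t⁻¹ * Q.ψ t))⁻¹)⁻¹
  rw [(isEdgeAt_inv_iff.1 h).1, mul_inv_rev', mul_inv_rev', inv_inv', mul_assoc]

theorem Ker.isEdgeAt (k : Ker Q e) : IsEdgeAt Q e (Q.ψ e.val) k.val := by
  have hinv : (Q.ψ e.val)⁻¹ = Q.ψ e.val := by rw [← map_inv', idem_inv e.idem]
  have hmul : Q.ψ e.val * Q.ψ e.val = Q.ψ e.val := by rw [← map_mul, e.idem]
  constructor <;> simp only [k.ψ_val, hinv, hmul]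

theorem exists_edgeLoop_eq_conj :
    ∃ c : Ker Q e, ∀ k : Ker Q e, edgeLoop k.isEdgeAt = c * k * c⁻¹ := by
  refine ⟨⟨Q.pick (Q.ψ e.val), Q.ψ_pick _⟩, fun k => Ker.ext ?_⟩
  change Q.pick (Q.ψ e.val) * k.val * (Q.pick (Q.ψ e.val * Q.ψ k.val))⁻¹ = _
  rw [k.ψ_val, ← map_mul, e.idem]
  rfl

open Classical in
/-- The monomial matrix of `t` on the vertices of the Schützenberger graph, as a function of the
row: the only entry of row `m` that can be nonzero is that of column `mψ(t)`. -/
noncomputable def transition (Q : SepQuotient ι T M) (e : Idem T) (t : T) (m : M) :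
    WithZero (Ker Q e) :=
  if h : IsEdgeAt Q e m t then edgeLoop h else 0

theorem transition_of_isEdgeAt (h : IsEdgeAt Q e m t) : transition Q e t m = edgeLoop h :=
  dif_pos h

theorem transition_ne_zero_iff : transition Q e t m ≠ 0 ↔ IsEdgeAt Q e m t := by
  rw [transition]
  split_ifs with h <;> simp [h]

open Classical in
theorem transition_one :
    transition Q e 1 m = if m * m⁻¹ = Q.ψ e.val then 1 else 0 := by
  rw [transition]
  simp only [edgeLoop_one, isEdgeAt_one_iff, WithZero.coe_one, dite_eq_ite]

theorem transition_mul :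
    transition Q e (t * t') m = transition Q e t m * transition Q e t' (m * Q.ψ t) := by
  by_cases h : IsEdgeAt Q e m (t * t')
  · obtain ⟨ht, ht'⟩ := isEdgeAt_mul_iff.1 h
    rw [transition_of_isEdgeAt h, transition_of_isEdgeAt ht, transition_of_isEdgeAt ht',
      ← WithZero.coe_mul, edgeLoop_mul ht ht' h]
  · have hne := h
    rw [← transition_ne_zero_iff, not_not] at h
    rw [isEdgeAt_mul_iff, ← transition_ne_zero_iff, ← transition_ne_zero_iff, ← mul_ne_zero_iff,
      not_not] at hne
    rw [h, hne]

open Classical in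
theorem transition_inv : transition Q e t⁻¹ m =
    if m * Q.ψ t⁻¹ * Q.ψ t = m then (transition Q e t (m * Q.ψ t⁻¹))⁻¹ else 0 := by
  by_cases h : IsEdgeAt Q e m t⁻¹
  · obtain ⟨hm, ht⟩ := isEdgeAt_inv_iff.1 h
    rw [if_pos hm, transition_of_isEdgeAt h, transition_of_isEdgeAt ht, ← WithZero.coe_inv,
      edgeLoop_inv h ht]
  · split_ifs with hm
    · have ht : ¬ IsEdgeAt Q e (m * Q.ψ t⁻¹) t := fun ht => h (isEdgeAt_inv_iff.2 ⟨hm, ht⟩)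
      rw [← transition_ne_zero_iff, not_not] at h ht
      rw [h, ht, inv_zero]
    · rwa [← transition_ne_zero_iff, not_not] at h

end SepQuotient

/-- A monoid with a regular inversion that maps to an inverse monoid and whose idempotents are
separated by this map is an inverse monoid. -/
abbrev InverseMonoid.ofSeparating {N : Type u} {S : Type v} [Monoid N] [Inv N] [InverseMonoid S]
    (π : N →* S) (hπ : ∀ {a b : N}, a * a = a → b * b = b → π a = π b → a = b)
    (mul_inv_mul : ∀ a : N, a * a⁻¹ * a = a) (inv_mul_inv : ∀ a : N, a⁻¹ * a * a⁻¹ = a⁻¹) :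
    InverseMonoid N where
  mul_inv_mul := mul_inv_mul
  inv_mul_inv := inv_mul_inv
  inv_unique a b hab hba := by
    have map_inv : π b = π a⁻¹ := by
      rw [inv_unique (π a) (π b) (by simp only [← map_mul, hab]) (by simp only [← map_mul, hba])]
      exact (inv_unique (π a) (π a⁻¹) (by simp only [← map_mul, mul_inv_mul])
        (by simp only [← map_mul, inv_mul_inv])).symm
    have hl : a * b = a * a⁻¹ := hπ (by rw [← mul_assoc, hab]) (by rw [← mul_assoc, mul_inv_mul])
      (by rw [map_mul, map_mul, map_inv])
    have hr : b * a = a⁻¹ * a := hπ (by rw [← mul_assoc, hba]) (by rw [← mul_assoc, inv_mul_inv])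
      (by rw [map_mul, map_mul, map_inv])
    rw [← hba, hr, mul_assoc, hl, ← mul_assoc, inv_mul_inv]

namespace SepQuotient

variable {ι : Type w} {T : Type u} {M : Type v} [InverseMonoid T] [InverseMonoid M]
  {Q : SepQuotient ι T M} {e : Idem T} {G : Type w'} [Group G]

/-- An element of `T` together with a lift of its monomial matrix along `f : G → K_e`. -/
@[ext] structure LiftedElement (f : G →* Ker Q e) where
  base : T
  entry : M → WithZero G
  map_entry : ∀ m, WithZero.map' f (entry m) = transition Q e base m

namespace LiftedElement

variable {f : G →* Ker Q e}

theorem isEdgeAt_of_entry_ne_zero {a : LiftedElement f} {m : M} (h : a.entry m ≠ 0) :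
    IsEdgeAt Q e m a.base := by
  rw [← transition_ne_zero_iff, ← a.map_entry]
  exact (map_ne_zero _).2 h

theorem entry_ne_zero {a : LiftedElement f} {m : M} (h : IsEdgeAt Q e m a.base) :
    a.entry m ≠ 0 := by
  rw [← transition_ne_zero_iff, ← a.map_entry] at h
  exact (map_ne_zero _).1 h

open Classical in
noncomputable instance : One (LiftedElement f) where
  one :=
    { base := 1
      entry := fun m => if m * m⁻¹ = Q.ψ e.val then 1 else 0
      map_entry := fun m => by rw [transition_one, apply_ite (WithZero.map' f), map_one, map_zero] }

instance : Mul (LiftedElement f) where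
  mul a b :=
    { base := a.base * b.base
      entry := fun m => a.entry m * b.entry (m * Q.ψ a.base)
      map_entry := fun m => by rw [map_mul, a.map_entry, b.map_entry, transition_mul] }

open Classical in
noncomputable instance : Inv (LiftedElement f) where
  inv a :=
    { base := a.base⁻¹
      entry := fun m =>
        if m * Q.ψ a.base⁻¹ * Q.ψ a.base = m then (a.entry (m * Q.ψ a.base⁻¹))⁻¹ else 0
      map_entry := fun m => by
        rw [transition_inv, apply_ite (WithZero.map' f), map_inv₀, a.map_entry, map_zero] }

variable (a b : LiftedElement f) (m : M)

theorem base_mul : (a * b).base = a.base * b.base := rfl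

theorem base_inv : a⁻¹.base = a.base⁻¹ := rfl

theorem entry_mul : (a * b).entry m = a.entry m * b.entry (m * Q.ψ a.base) := rfl

open Classical in
theorem entry_inv : a⁻¹.entry m =
    if m * Q.ψ a.base⁻¹ * Q.ψ a.base = m then (a.entry (m * Q.ψ a.base⁻¹))⁻¹ else 0 := rfl

variable {m} in
theorem entry_one (h : m * m⁻¹ = Q.ψ e.val) : (1 : LiftedElement f).entry m = 1 := if_pos h

noncomputable instance : Monoid (LiftedElement f) where
  mul_assoc a b c := by
    refine LiftedElement.ext (mul_assoc a.base b.base c.base) (funext fun m => ?_)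
    simp only [entry_mul, base_mul, map_mul, mul_assoc]
  one_mul a := by
    refine LiftedElement.ext (one_mul a.base) (funext fun m => ?_)
    have hm : m * Q.ψ (1 : LiftedElement f).base = m := (congrArg _ Q.ψ.map_one).trans (mul_one m)
    rw [entry_mul, hm]
    by_cases h : a.entry m = 0
    · rw [h, mul_zero]
    · rw [entry_one (isEdgeAt_of_entry_ne_zero h).1, one_mul]
  mul_one a := by
    refine LiftedElement.ext (mul_one a.base) (funext fun m => ?_)
    rw [entry_mul]
    by_cases h : a.entry m = 0
    · rw [h, zero_mul]
    · rw [entry_one (isEdgeAt_of_entry_ne_zero h).mul_mul_inv, mul_one]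

theorem mul_inv_mul_self : a * a⁻¹ * a = a := by
  refine LiftedElement.ext (mul_inv_mul a.base) (funext fun m => ?_)
  by_cases h : a.entry m = 0
  · rw [entry_mul, entry_mul, h, zero_mul, zero_mul]
  · have hm : m * Q.ψ a.base * Q.ψ a.base⁻¹ = m := by
      rw [map_inv', (isEdgeAt_of_entry_ne_zero h).2]
    have hm' : m * Q.ψ (a * a⁻¹).base = m := by rw [base_mul, base_inv, map_mul, ← mul_assoc, hm]
    rw [entry_mul, entry_mul, entry_inv, hm, if_pos rfl, hm', mul_inv_cancel₀ h, one_mul]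

theorem inv_mul_inv_self : a⁻¹ * a * a⁻¹ = a⁻¹ := by
  refine LiftedElement.ext (inv_mul_inv a.base) (funext fun m => ?_)
  by_cases h : a⁻¹.entry m = 0
  · rw [entry_mul, entry_mul, h, zero_mul, zero_mul]
  · have hm : m * Q.ψ a.base⁻¹ * Q.ψ a.base = m :=
      (isEdgeAt_inv_iff.1 (isEdgeAt_of_entry_ne_zero h)).1
    have hm' : m * Q.ψ (a⁻¹ * a).base = m := by rw [base_mul, base_inv, map_mul, ← mul_assoc, hm]
    rw [entry_mul, entry_mul, hm', base_inv]
    rw [entry_inv, if_pos hm] at h ⊢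
    rw [inv_mul_cancel₀ (mt inv_eq_zero.2 h), one_mul]

variable {a b m}

theorem entry_eq_one_of_idem (ha : a * a = a) (h : IsEdgeAt Q e m a.base) : a.entry m = 1 := by
  have hbase : Q.ψ a.base * Q.ψ a.base = Q.ψ a.base := by rw [← map_mul, ← base_mul, ha]
  have hm : m * Q.ψ a.base = m := by
    have hm := h.2
    rwa [idem_inv hbase, mul_assoc, hbase] at hm
  have hentry : a.entry m * a.entry m = a.entry m := by
    conv_rhs => rw [← ha, entry_mul, hm]
  exact (mul_eq_left₀ (entry_ne_zero h)).1 hentry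

theorem eq_of_idem_of_base_eq (ha : a * a = a) (hb : b * b = b) (h : a.base = b.base) : a = b := by
  refine LiftedElement.ext h (funext fun m => ?_)
  by_cases hm : IsEdgeAt Q e m a.base
  · rw [entry_eq_one_of_idem ha hm, entry_eq_one_of_idem hb (h ▸ hm)]
  · rw [not_not.1 (mt isEdgeAt_of_entry_ne_zero hm),
      not_not.1 (mt isEdgeAt_of_entry_ne_zero (h ▸ hm))]

variable (f) in
/-- The projection from the lifted elements to `T`. -/
def baseHom : LiftedElement f →* T where
  toFun := base
  map_one' := rfl
  map_mul' _ _ := rfl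

noncomputable instance : InverseMonoid (LiftedElement f) :=
  ofSeparating (baseHom f) eq_of_idem_of_base_eq mul_inv_mul_self inv_mul_inv_self

theorem baseHom_surjective (hf : Function.Surjective f) : Function.Surjective (baseHom f) := by
  have hmap : Function.Surjective (WithZero.map' f) := by
    intro x
    induction x with
    | zero => exact ⟨0, map_zero _⟩
    | coe k =>
      obtain ⟨g, rfl⟩ := hf k
      exact ⟨g, rfl⟩
  intro t
  choose entry h_entry using fun m => hmap (transition Q e t m)
  exact ⟨⟨t, entry, h_entry⟩, rfl⟩

theorem exists_section_of_section_baseHom (hf : Function.Surjective f) {s : T →* LiftedElement f}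
    (hs : ∀ t, (s t).base = t) : ∃ σ : Ker Q e →* G, ∀ k, f (σ k) = k := by
  have ne_zero : ∀ k : Ker Q e, (s k.val).entry (Q.ψ e.val) ≠ 0 := fun k =>
    entry_ne_zero ((hs k.val).symm ▸ k.isEdgeAt)
  choose g hg using fun k => WithZero.ne_zero_iff_exists.1 (ne_zero k)
  have g_mul : ∀ k k', g (k * k') = g k * g k' := by
    intro k k'
    rw [← WithZero.coe_inj, WithZero.coe_mul, hg, hg, hg]
    change (s (k.val * k'.val)).entry _ = _
    rw [map_mul, entry_mul, hs, k.ψ_val, ← map_mul, e.idem]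
  have f_g : ∀ k, f (g k) = edgeLoop k.isEdgeAt := by
    intro k
    rw [← WithZero.coe_inj, ← transition_of_isEdgeAt, ← WithZero.map'_coe, hg,
      (s k.val).map_entry, hs]
  obtain ⟨c, hc⟩ := exists_edgeLoop_eq_conj (Q := Q) (e := e)
  obtain ⟨u, rfl⟩ := hf c
  refine ⟨(MulAut.conj u⁻¹).toMonoidHom.comp (MonoidHom.mk' g g_mul), fun k => ?_⟩
  change f (u⁻¹ * g k * u⁻¹⁻¹) = k
  rw [inv_inv, map_mul, map_mul, map_inv, f_g, hc]
  group

end LiftedElement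

end SepQuotient

theorem InvPresentation.exists_section {X : Type u} {M : Type v} [InverseMonoid M]
    (P : InvPresentation X M) (e : Idem P.T) {G : Type w} [Group G]
    (f : G →* SepQuotient.Ker P.sep e) (hf : Function.Surjective f) :
    ∃ σ : SepQuotient.Ker P.sep e →* G, ∀ k, f (σ k) = k := by
  obtain ⟨_, hs⟩ :=
    P.exists_section_of_separating (SepQuotient.LiftedElement.baseHom_surjective hf) fun a b h =>
      Idem.ext (SepQuotient.LiftedElement.eq_of_idem_of_base_eq a.idem b.idem h)
  exact SepQuotient.LiftedElement.exists_section_of_section_baseHom hf hs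

/-! ### Exactness -/

section Abelianization

variable {G : Type u} {K : Type v} [Group G] [Group K] {f : G →* K}

theorem mul_inv_section_mem_center {σ : K →* G} (hσ : ∀ k, f (σ k) = k)
    (hf : f.ker ≤ Subgroup.center G) (g : G) : g * (σ (f g))⁻¹ ∈ Subgroup.center G :=
  hf (by rw [MonoidHom.mem_ker, map_mul, map_inv, hσ, mul_inv_cancel])

/-- The retraction `g ↦ g σ(f(g))⁻¹` onto the centre that belongs to a section `σ` of a homomorphism
`f` with central kernel. -/
def centerRetraction {σ : K →* G} (hσ : ∀ k, f (σ k) = k) (hf : f.ker ≤ Subgroup.center G) :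
    G →* Subgroup.center G :=
  MonoidHom.mk' (fun g => ⟨g * (σ (f g))⁻¹, mul_inv_section_mem_center hσ hf g⟩) fun g g' => by
    have hcomm : g' * (σ (f g'))⁻¹ * (σ (f g))⁻¹ = (σ (f g))⁻¹ * (g' * (σ (f g'))⁻¹) :=
      (Subgroup.mem_center_iff.1 (mul_inv_section_mem_center hσ hf g') _).symm
    refine Subtype.ext ?_
    calc g * g' * (σ (f (g * g')))⁻¹ = g * (g' * (σ (f g'))⁻¹ * (σ (f g))⁻¹) := by
          simp only [map_mul, mul_inv_rev, mul_assoc]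
      _ = g * (σ (f g))⁻¹ * (g' * (σ (f g'))⁻¹) := by rw [hcomm, mul_assoc]

open scoped IsMulCommutative in
theorem eq_one_of_abelianization_of_eq_one {σ : K →* G} (hσ : ∀ k, f (σ k) = k)
    (hf : f.ker ≤ Subgroup.center G) {a : G} (ha : f a = 1) (h : Abelianization.of a = 1) :
    a = 1 := by
  have hr : centerRetraction hσ hf a = 1 :=
    Abelianization.commutator_subset_ker (centerRetraction hσ hf)
      (by rwa [← Abelianization.ker_of G, MonoidHom.mem_ker])
  have hmul : a * (σ (f a))⁻¹ = 1 := congrArg Subtype.val hr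
  rwa [ha, map_one, inv_one, mul_one] at hmul

theorem exists_mem_ker_abelianization_of_eq (hf : Function.Surjective f) {a : G}
    (h : Abelianization.of (f a) = 1) :
    ∃ b ∈ f.ker, Abelianization.of b = Abelianization.of a := by
  have hmap : (commutator G).map f = commutator K := by
    rw [commutator_def, commutator_def, Subgroup.map_commutator,
      Subgroup.map_top_of_surjective f hf]
  rw [← MonoidHom.mem_ker, Abelianization.ker_of, ← hmap] at h
  obtain ⟨c, hc, hca⟩ := h
  rw [SetLike.mem_coe, ← Abelianization.ker_of, MonoidHom.mem_ker] at hc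
  exact ⟨c⁻¹ * a, by rw [MonoidHom.mem_ker, map_mul, map_inv, hca, inv_mul_cancel],
    by rw [map_mul, map_inv, hc, inv_one, one_mul]⟩

end Abelianization

namespace SepQuotient

variable {ι : Type w} {T : Type u} {M : Type v} [InverseMonoid T] [InverseMonoid M]
  {Q : SepQuotient ι T M}

theorem Star.mem_identityGroup_iff {e : Idem T} {α : Star Q e} :
    α ∈ Q.IdentityGroup e ↔ Star.range α = 1 :=
  ⟨fun h => Ker.ext h, congrArg Ker.val⟩

theorem Star.ker_range_le_center (e : Idem T) :
    (Star.range : Star Q e →* Ker Q e).ker ≤ Subgroup.center (Star Q e) := fun _ hα =>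
  Subgroup.mem_center_iff.2 (IdentityGroup.central (Star.mem_identityGroup_iff.2 hα))

theorem shortExact_of_section
    (H : ∀ e : Idem T, ∃ σ : Ker Q e →* Star Q e, ∀ k, Star.range (σ k) = k) :
    LauschModule.ShortExact Q.inclusionHom Q.rangeHom where
  injective e := by
    obtain ⟨σ, hσ⟩ := H (Q.lift e)
    refine (injective_iff_map_eq_zero _).2 fun a ha => ?_
    induction a using Additive.rec with | _ a
    exact congrArg Additive.ofMul <| Subtype.ext <|
      eq_one_of_abelianization_of_eq_one hσ (Star.ker_range_le_center _)
        (Star.mem_identityGroup_iff.1 a.2) (congrArg Additive.toMul ha)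
  exact e a := by
    constructor
    · intro ha
      induction a using Additive.rec with | _ a
      induction a using QuotientGroup.induction_on with | _ α
      obtain ⟨β, hβ, hβα⟩ := exists_mem_ker_abelianization_of_eq (a := α) Star.range_surjective
        (congrArg Additive.toMul ha)
      exact ⟨Additive.ofMul ⟨β, Star.mem_identityGroup_iff.2 hβ⟩, congrArg Additive.ofMul hβα⟩
    · rintro ⟨b, rfl⟩
      induction b using Additive.rec with | _ b
      refine congrArg Additive.ofMul (?_ : Abelianization.of (Star.range b.1) = 1)
      rw [Star.mem_identityGroup_iff.1 b.2, map_one]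
  surjective e a := by
    induction a using Additive.rec with | _ a
    induction a using QuotientGroup.induction_on with | _ k
    obtain ⟨α, rfl⟩ := Star.range_surjective k
    exact ⟨Additive.ofMul (Abelianization.of α), rfl⟩

end SepQuotient

theorem mainTheorem1 {X : Type u} {M : Type v} [InverseMonoid M] (P : InvPresentation X M) :
    LauschModule.ShortExact P.inclusion P.rangeMap ∧
      LauschModule.IsFree.{v, u, u} P.squierModule :=
  ⟨SepQuotient.shortExact_of_section fun e =>
      P.exists_section e _ SepQuotient.Star.range_surjective,
    SepQuotient.starModule_isFree⟩
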